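/- Let $n,m\ge 0$ be integers and let $u=(u^1,\dots,u^m):\mathbb R^n\to\mathbb R^m$ be a smooth map defined on all of $\mathbb R^n$. Let $M=\{(x,u(x)) : x\in\mathbb R^n\}\subset\mathbb R^{n+m}$ be its graph, with the metric induced from the Euclidean metric, $g_{ij}=\delta_{ij}+\sum_{\alpha}\partial_iu^\alpha\,\partial_ju^\alpha$. Suppose that $M$ is a self-shrinker, that is, at every point of $M$, $$H=-X^N,$$ where $X=(x,u(x))$ is the position vector, $(\cdot)^N$ is the orthogonal projection onto the normal space of $M$, and $H=\sum_{i,j}g^{ij}\,(\partial_i\partial_jX)^N$ is the mean curvature vector. (Equivalently, $\sum_{i,j}g^{ij}\,\partial_i\partial_ju^\alpha=-u^\alpha+x\cdot Du^\alpha$ on $\mathbb R^n$ for $\alpha=1,\dots,m$.) Suppose moreover that the normal bundle of $M$ is flat (that is, the curvature $R^\perp(V,W)\xi=\nabla^\perp_V\nabla^\perp_W\xi-\nabla^\perp_W\nabla^\perp_V\xi-\nabla^\perp_{[V,W]}\xi$ of the normal connection $\nabla^\perp_V\xi=(D_V\xi)^N$, where $D$ is the flat connection of $\mathbb R^{n+m}$,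 vanishes identically), or that the codimension $m$ equals $1$. Then $M$ is a linear subspace of $\mathbb R^{n+m}$. -/

import Mathlib

open scoped ContDiff

noncomputable section

namespace SelfShrinker

/-! Geometry of a parametrized immersed submanifold `F : ℝⁿ → E`, with `E` a Euclidean space. -/

section Immersion

variable {n : ℕ} {E : Type*} [NormedAddCommGroup E] [InnerProductSpace ℝ E]

/-- The `i`-th coordinate tangent vector `∂F/∂xᵢ` at `x`. -/
def coordTangent (F : EuclideanSpace ℝ (Fin n) → E) (x : EuclideanSpace ℝ (Fin n))
    (i : Fin n) : E :=
  fderiv ℝ F x (EuclideanSpace.single i 1)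

/-- The tangent space of the immersed submanifold at the point with parameter `x`. -/
def tangentSpace (F : EuclideanSpace ℝ (Fin n) → E) (x : EuclideanSpace ℝ (Fin n)) :
    Submodule ℝ E :=
  LinearMap.range (fderiv ℝ F x : EuclideanSpace ℝ (Fin n) →ₗ[ℝ] E)

/-- The normal space of the immersed submanifold at the point with parameter `x`. -/
def normalSpace (F : EuclideanSpace ℝ (Fin n) → E) (x : EuclideanSpace ℝ (Fin n)) :
    Submodule ℝ E :=
  (tangentSpace F x)ᗮ

/-- The induced metric `g_ij = ⟨∂F/∂xᵢ, ∂F/∂xⱼ⟩`. -/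
def inducedMetric (F : EuclideanSpace ℝ (Fin n) → E) (x : EuclideanSpace ℝ (Fin n)) :
    Matrix (Fin n) (Fin n) ℝ :=
  Matrix.of fun i j => inner ℝ (coordTangent F x i) (coordTangent F x j)

variable [FiniteDimensional ℝ E]

/-- The normal part `v ↦ v^N`: orthogonal projection of `E` onto the normal space at `x`. -/
def normalPart (F : EuclideanSpace ℝ (Fin n) → E) (x : EuclideanSpace ℝ (Fin n)) (v : E) : E :=
  (normalSpace F x).starProjection v

/-- The second fundamental form on coordinate vectors, `B(∂ᵢ, ∂ⱼ) = (∂²F/∂xᵢ∂xⱼ)^N`. -/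
def secondFundamentalForm (F : EuclideanSpace ℝ (Fin n) → E) (x : EuclideanSpace ℝ (Fin n))
    (i j : Fin n) : E :=
  normalPart F x (fderiv ℝ (fun y => coordTangent F y j) x (EuclideanSpace.single i 1))

/-- The mean curvature vector, the (unnormalized) trace of the second fundamental form with
respect to the induced metric: `H = ∑ g^{ij} B(∂ᵢ, ∂ⱼ)`. -/
def meanCurvature (F : EuclideanSpace ℝ (Fin n) → E) (x : EuclideanSpace ℝ (Fin n)) : E :=
  ∑ i, ∑ j, ((inducedMetric F x)⁻¹ i j) • secondFundamentalForm F x i j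

/-- The self-shrinker equation `H = -X^N`, where `X` is the position vector. -/
def IsSelfShrinker (F : EuclideanSpace ℝ (Fin n) → E) : Prop :=
  ∀ x, meanCurvature F x = -normalPart F x (F x)

/-- The normal connection `∇^⊥_V ξ = (D_V ξ)^N`, for a tangent vector field `V` (given in the
parameter domain) and a normal field `ξ` along `F`. -/
def normalConnection (F : EuclideanSpace ℝ (Fin n) → E)
    (V : EuclideanSpace ℝ (Fin n) → EuclideanSpace ℝ (Fin n))
    (ξ : EuclideanSpace ℝ (Fin n) → E) (x : EuclideanSpace ℝ (Fin n)) : E :=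
  normalPart F x (fderiv ℝ ξ x (V x))

/-- The curvature of the normal connection,
`R^⊥(V, W) ξ = ∇^⊥_V ∇^⊥_W ξ - ∇^⊥_W ∇^⊥_V ξ - ∇^⊥_{[V, W]} ξ`. -/
def normalCurvature (F : EuclideanSpace ℝ (Fin n) → E)
    (V W : EuclideanSpace ℝ (Fin n) → EuclideanSpace ℝ (Fin n))
    (ξ : EuclideanSpace ℝ (Fin n) → E) (x : EuclideanSpace ℝ (Fin n)) : E :=
  normalConnection F V (normalConnection F W ξ) x
    - normalConnection F W (normalConnection F V ξ) x
    - normalConnection F (VectorField.lieBracket ℝ V W) ξ x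

/-- The normal bundle is flat: the normal connection has zero curvature. -/
def HasFlatNormalBundle (F : EuclideanSpace ℝ (Fin n) → E) : Prop :=
  ∀ (V W : EuclideanSpace ℝ (Fin n) → EuclideanSpace ℝ (Fin n))
    (ξ : EuclideanSpace ℝ (Fin n) → E),
    ContDiff ℝ ∞ V → ContDiff ℝ ∞ W → ContDiff ℝ ∞ ξ → (∀ x, ξ x ∈ normalSpace F x) →
    ∀ x, normalCurvature F V W ξ x = 0

end Immersion

/-- The parametrization `x ↦ (x, u(x))` of the graph of `u : ℝⁿ → ℝᵐ`, as a map into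
`ℝⁿ⁺ᵐ`, whose coordinates are indexed by `Fin n ⊕ Fin m`. -/
def graphMap {n m : ℕ} (u : EuclideanSpace ℝ (Fin n) → EuclideanSpace ℝ (Fin m))
    (x : EuclideanSpace ℝ (Fin n)) : EuclideanSpace ℝ (Fin n ⊕ Fin m) :=
  WithLp.toLp 2 (Sum.elim (fun i => x i) (fun a => u x a))

end SelfShrinker

end

/-! The argument is a Bochner identity integrated against the Gaussian weight. Let `ρ = √(det g) ·
exp(-|X|²/2)`. The shrinker equation turns the weighted Laplacian `ρ⁻¹ ∂ᵢ(ρ g^{ij} ∂ⱼ f)` into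
`g^{ij} ∂ᵢ∂ⱼ f - x · Df`, an operator that is symmetric with respect to `ρ dx` (`sum_pd_flux`).

Apply it to `w = log √(det g)`, whose differential is `logVolumeDeriv`. When the shape operators
commute, the result is `|B|² + |∇w|²` (`sum_inv_mul_pd_logVolumeDeriv`). Commutation is Ricci's
equation for a flat normal bundle, and is trivial in codimension one.

Testing with `η²` and using `0 ≤ |dη + η dw|²` absorbs the gradient of `w` completely, so no bound
on `Du` is needed: `∫ ρ η² |B|² ≤ ∫ ρ |dη|²`. For `η = ((1 - |X|²/R)₊)²` the right side is at most
`16/R² ∫ ρ η |X|²`. The same operator sends `|X|²/2` to `n - |X|²`, which bounds `∫ ρ η |X|²`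
independently of `R` and takes the place of an area growth theorem.

Letting `R → ∞` gives `B = 0`, hence `D²u = 0`. The shrinker equation then reads `u = x · Du` with
`Du` constant, so `u` is linear. -/

namespace SelfShrinker

/-! ### Partial derivatives -/

section Calculus

variable {n : ℕ} {V : Type*} [NormedAddCommGroup V] [NormedSpace ℝ V]

/-- The partial derivative `∂f/∂xᵢ`. -/
noncomputable def pd (i : Fin n) (f : EuclideanSpace ℝ (Fin n) → V)
    (x : EuclideanSpace ℝ (Fin n)) : V :=
  fderiv ℝ f x (EuclideanSpace.single i 1)

theorem contDiff_pd {f : EuclideanSpace ℝ (Fin n) → V} (hf : ContDiff ℝ ∞ f) (i : Fin n) :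
    ContDiff ℝ ∞ (pd i f) :=
  (hf.fderiv_right (m := ∞) (by simp)).clm_apply contDiff_const

theorem pd_const (i : Fin n) (c : V) (x : EuclideanSpace ℝ (Fin n)) :
    pd i (fun _ => c) x = 0 := by
  simp [pd]

theorem pd_add {f g : EuclideanSpace ℝ (Fin n) → V} {x : EuclideanSpace ℝ (Fin n)}
    (hf : DifferentiableAt ℝ f x) (hg : DifferentiableAt ℝ g x) (i : Fin n) :
    pd i (fun y => f y + g y) x = pd i f x + pd i g x := by
  simp [pd, fderiv_fun_add hf hg]

theorem pd_neg (f : EuclideanSpace ℝ (Fin n) → V) (x : EuclideanSpace ℝ (Fin n)) (i : Fin n) :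
    pd i (fun y => -f y) x = -pd i f x := by
  simp [pd, fderiv_fun_neg]

theorem pd_sub {f g : EuclideanSpace ℝ (Fin n) → V} {x : EuclideanSpace ℝ (Fin n)}
    (hf : DifferentiableAt ℝ f x) (hg : DifferentiableAt ℝ g x) (i : Fin n) :
    pd i (fun y => f y - g y) x = pd i f x - pd i g x := by
  simp [pd, fderiv_fun_sub hf hg]

theorem pd_sum {ι : Type*} {s : Finset ι} {f : ι → EuclideanSpace ℝ (Fin n) → V}
    {x : EuclideanSpace ℝ (Fin n)} (hf : ∀ k ∈ s, DifferentiableAt ℝ (f k) x) (i : Fin n) :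
    pd i (fun y => ∑ k ∈ s, f k y) x = ∑ k ∈ s, pd i (f k) x := by
  simp [pd, fderiv_fun_sum hf]

theorem pd_smul {c : EuclideanSpace ℝ (Fin n) → ℝ} {f : EuclideanSpace ℝ (Fin n) → V}
    {x : EuclideanSpace ℝ (Fin n)}
    (hc : DifferentiableAt ℝ c x) (hf : DifferentiableAt ℝ f x) (i : Fin n) :
    pd i (fun y => c y • f y) x = pd i c x • f x + c x • pd i f x := by
  simp [pd, fderiv_fun_smul hc hf, add_comm]

theorem pd_mul {f g : EuclideanSpace ℝ (Fin n) → ℝ} {x : EuclideanSpace ℝ (Fin n)}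
    (hf : DifferentiableAt ℝ f x) (hg : DifferentiableAt ℝ g x) (i : Fin n) :
    pd i (fun y => f y * g y) x = pd i f x * g x + f x * pd i g x := by
  simpa using pd_smul hf hg i

theorem pd_comp {φ : ℝ → ℝ} {φ' : ℝ} {f : EuclideanSpace ℝ (Fin n) → ℝ}
    {x : EuclideanSpace ℝ (Fin n)} (hφ : HasDerivAt φ φ' (f x))
    (hf : DifferentiableAt ℝ f x) (i : Fin n) :
    pd i (fun y => φ (f y)) x = φ' * pd i f x := by
  have := (hφ.comp_hasFDerivAt x hf.hasFDerivAt).fderiv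
  rw [Function.comp_def] at this
  simp [pd, this]

theorem pd_clm {W : Type*} [NormedAddCommGroup W] [NormedSpace ℝ W] (l : V →L[ℝ] W)
    {f : EuclideanSpace ℝ (Fin n) → V} {x : EuclideanSpace ℝ (Fin n)}
    (hf : DifferentiableAt ℝ f x) (i : Fin n) :
    pd i (fun y => l (f y)) x = l (pd i f x) := by
  have := (l.hasFDerivAt.comp x hf.hasFDerivAt).fderiv
  rw [Function.comp_def] at this
  simp [pd, this]

theorem pd_coord (i j : Fin n) (x : EuclideanSpace ℝ (Fin n)) :
    pd i (fun y => y j) x = if j = i then 1 else 0 := by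
  have h : HasFDerivAt (fun y : EuclideanSpace ℝ (Fin n) => y j)
      (EuclideanSpace.proj j : EuclideanSpace ℝ (Fin n) →L[ℝ] ℝ) x :=
    (EuclideanSpace.proj j : EuclideanSpace ℝ (Fin n) →L[ℝ] ℝ).hasFDerivAt
  simp [pd, h.fderiv]

theorem pd_comm {f : EuclideanSpace ℝ (Fin n) → V} (hf : ContDiff ℝ ∞ f) (i j : Fin n)
    (x : EuclideanSpace ℝ (Fin n)) : pd i (pd j f) x = pd j (pd i f) x := by
  have hd : DifferentiableAt ℝ (fderiv ℝ f) x :=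
    ((hf.fderiv_right (m := ∞) (by simp)).differentiable (by simp)) x
  have key : ∀ k l : Fin n, pd k (pd l f) x =
      fderiv ℝ (fderiv ℝ f) x (EuclideanSpace.single k 1) (EuclideanSpace.single l 1) := by
    intro k l
    have : pd l f = fun y => fderiv ℝ f y (EuclideanSpace.single l 1) := rfl
    rw [this, pd, fderiv_clm_apply hd (differentiableAt_const _)]
    simp
  rw [key, key]
  exact (hf.contDiffAt.isSymmSndFDerivAt
    (by rw [minSmoothness_of_isRCLikeNormedField]; exact ENat.LEInfty.out)) _ _

/-- The derivative in terms of the partial derivatives. -/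
theorem fderiv_apply_eq_sum_pd (f : EuclideanSpace ℝ (Fin n) → V)
    (x v : EuclideanSpace ℝ (Fin n)) : fderiv ℝ f x v = ∑ i, v i • pd i f x := by
  conv_lhs => rw [← (EuclideanSpace.basisFun (Fin n) ℝ).sum_repr v]
  simp [pd]

/-- Compact support of `φ` alone makes all three products integrable. Only `C¹` is asked because the
cutoffs used later are no smoother. -/
theorem integral_mul_pd {φ ψ : EuclideanSpace ℝ (Fin n) → ℝ} (hφ : ContDiff ℝ 1 φ)
    (hc : HasCompactSupport φ) (hψ : ContDiff ℝ 1 ψ) (i : Fin n) :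
    ∫ x, φ x * pd i ψ x = -∫ x, pd i φ x * ψ x := by
  have hcψ : Continuous (pd i ψ) := (hψ.continuous_fderiv (by simp)).clm_apply continuous_const
  have hcφ : Continuous (pd i φ) := (hφ.continuous_fderiv (by simp)).clm_apply continuous_const
  have hs : HasCompactSupport (pd i φ) := hc.fderiv_apply ℝ _
  refine integral_mul_fderiv_eq_neg_fderiv_mul_of_integrable ?_ ?_ ?_
    (fun x _ => (hφ.differentiable (by simp)) x) (fun x _ => (hψ.differentiable (by simp)) x)
  · exact (hcφ.mul hψ.continuous).integrable_of_hasCompactSupport hs.mul_right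
  · exact (hφ.continuous.mul hcψ).integrable_of_hasCompactSupport hc.mul_right
  · exact (hφ.continuous.mul hψ.continuous).integrable_of_hasCompactSupport hc.mul_right

end Calculus

/-! ### Determinants and inverses of matrix-valued functions -/

section MatrixCalculus

variable {n k : ℕ} {A : EuclideanSpace ℝ (Fin n) → Matrix (Fin k) (Fin k) ℝ}

theorem contDiff_det (hA : ∀ i j, ContDiff ℝ ∞ fun x => A x i j) :
    ContDiff ℝ ∞ fun x => (A x).det := by
  simp_rw [Matrix.det_apply']
  exact ContDiff.sum fun σ _ => contDiff_const.mul (contDiff_prod fun i _ => hA _ _)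

theorem contDiff_inv_apply (hA : ∀ i j, ContDiff ℝ ∞ fun x => A x i j)
    (h0 : ∀ x, (A x).det ≠ 0) (i j : Fin k) : ContDiff ℝ ∞ fun x => (A x)⁻¹ i j := by
  simp only [Matrix.inv_def, Ring.inverse_eq_inv', Matrix.smul_apply, smul_eq_mul]
  refine ((contDiff_det hA).inv h0).mul ?_
  simp_rw [Matrix.adjugate_apply]
  refine contDiff_det fun a b => ?_
  by_cases h : a = j
  · subst h; simpa using contDiff_const
  · simpa [Matrix.updateRow_ne h] using hA a b

/-- Jacobi's formula. -/
theorem pd_det (hA : ∀ i j, ContDiff ℝ ∞ fun x => A x i j) (l : Fin n)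
    (x : EuclideanSpace ℝ (Fin n)) :
    pd l (fun y => (A y).det) x =
      ∑ i, ∑ j, (A x).adjugate i j * pd l (fun y => A y j i) x := by
  have hd : ∀ i j, DifferentiableAt ℝ (fun x => A x i j) x :=
    fun i j => (hA i j).differentiable (by simp) x
  -- By Cramer's rule each inner sum is the determinant with column `i` replaced by its derivative;
  -- the claim becomes the product rule in the Leibniz expansion.
  have h1 : ∀ i, ∑ j, (A x).adjugate i j * pd l (fun y => A y j i) x =
      ((A x).updateCol i fun j => pd l (fun y => A y j i) x).det := by
    intro i
    rw [← Matrix.cramer_apply, Matrix.cramer_eq_adjugate_mulVec]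
    rfl
  have h2 : ∀ σ : Equiv.Perm (Fin k), HasFDerivAt (fun y => ∏ i, A y (σ i) i)
      (∑ i, (∏ j ∈ Finset.univ.erase i, A x (σ j) j) • fderiv ℝ (fun y => A y (σ i) i) x) x :=
    fun σ => HasFDerivAt.finsetProd fun i _ => (hd _ _).hasFDerivAt
  simp_rw [h1, Matrix.det_apply']
  rw [Finset.sum_comm, pd_sum fun σ _ => (h2 σ).differentiableAt.const_mul _]
  refine Finset.sum_congr rfl fun σ _ => ?_
  rw [← Finset.mul_sum, pd_mul (differentiableAt_const _) (h2 σ).differentiableAt, pd_const,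
    zero_mul, zero_add]
  congr 1
  rw [pd, (h2 σ).fderiv]
  simp only [sum_apply, smul_apply, smul_eq_mul]
  refine Finset.sum_congr rfl fun i _ => ?_
  rw [← Finset.prod_erase_mul _ _ (Finset.mem_univ i)]
  congr 1
  · refine Finset.prod_congr rfl fun j hj => ?_
    rw [Matrix.updateCol_ne (Finset.ne_of_mem_erase hj)]
  · simp [pd]

/-- The derivative of the matrix inverse. -/
theorem pd_inv (hA : ∀ i j, ContDiff ℝ ∞ fun x => A x i j) (h0 : ∀ x, (A x).det ≠ 0)
    (l : Fin n) (x : EuclideanSpace ℝ (Fin n)) (i j : Fin k) :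
    pd l (fun y => (A y)⁻¹ i j) x =
      -∑ p, ∑ q, (A x)⁻¹ i p * pd l (fun y => A y p q) x * (A x)⁻¹ q j := by
  have hd : ∀ i j, DifferentiableAt ℝ (fun x => A x i j) x :=
    fun i j => (hA i j).differentiable (by simp) x
  have hi : ∀ i j, DifferentiableAt ℝ (fun x => (A x)⁻¹ i j) x :=
    fun i j => (contDiff_inv_apply hA h0 i j).differentiable (by simp) x
  let B : Matrix (Fin k) (Fin k) ℝ := Matrix.of fun i j => pd l (fun y => (A y)⁻¹ i j) x
  let C : Matrix (Fin k) (Fin k) ℝ := Matrix.of fun i j => pd l (fun y => A y i j) x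
  have hu : ∀ y, IsUnit (A y).det := fun y => isUnit_iff_ne_zero.mpr (h0 y)
  -- This is the derivative of the identity `A⁻¹ A = 1`.
  have h1 : B * A x + (A x)⁻¹ * C = 0 := by
    ext a b
    have h2 : (fun y => ∑ p, (A y)⁻¹ a p * A y p b) = fun _ => (1 : Matrix _ _ ℝ) a b := by
      funext y
      rw [← Matrix.mul_apply, Matrix.nonsing_inv_mul _ (hu y)]
    have h3 := congrArg (fun f => pd l f x) h2
    simp only [pd_const] at h3
    rw [pd_sum fun p _ => (hi a p).fun_mul (hd p b)] at h3
    simp_rw [pd_mul (hi a _) (hd _ b)] at h3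
    rw [Finset.sum_add_distrib] at h3
    simpa [Matrix.mul_apply, B, C] using h3
  have h4 : B = -((A x)⁻¹ * C * (A x)⁻¹) := by
    have := congrArg (· * (A x)⁻¹) h1
    simp only [add_mul, zero_mul, mul_assoc, Matrix.mul_nonsing_inv _ (hu x), mul_one] at this
    rw [mul_assoc]
    exact eq_neg_of_add_eq_zero_left this
  have h5 := congrFun (congrFun h4 i) j
  simp only [Matrix.neg_apply, Matrix.mul_apply, Finset.sum_mul] at h5
  rw [Finset.sum_comm] at h5
  exact h5

end MatrixCalculus

/-! ### Geometry of graphs -/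

section Graph

variable {n m : ℕ} {u : EuclideanSpace ℝ (Fin n) → EuclideanSpace ℝ (Fin m)}

/-- The Jacobian matrix `∂ᵢuᵅ`. -/
noncomputable def jac (u : EuclideanSpace ℝ (Fin n) → EuclideanSpace ℝ (Fin m))
    (x : EuclideanSpace ℝ (Fin n)) : Matrix (Fin m) (Fin n) ℝ :=
  Matrix.of fun a i => pd i (fun y => u y a) x

/-- The Hessian matrix of the component `uᵅ`. -/
noncomputable def hess (u : EuclideanSpace ℝ (Fin n) → EuclideanSpace ℝ (Fin m))
    (a : Fin m) (x : EuclideanSpace ℝ (Fin n)) : Matrix (Fin n) (Fin n) ℝ :=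
  Matrix.of fun i j => pd i (pd j (fun y => u y a)) x

/-- The metric of the graph of `u`. -/
noncomputable def graphMetric (u : EuclideanSpace ℝ (Fin n) → EuclideanSpace ℝ (Fin m))
    (x : EuclideanSpace ℝ (Fin n)) : Matrix (Fin n) (Fin n) ℝ :=
  1 + (jac u x).transpose * jac u x

/-- The normal field `(-∇uᵅ, e_α)` along the graph of `u`. -/
noncomputable def graphNormal (u : EuclideanSpace ℝ (Fin n) → EuclideanSpace ℝ (Fin m))
    (a : Fin m) (x : EuclideanSpace ℝ (Fin n)) : EuclideanSpace ℝ (Fin n ⊕ Fin m) :=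
  WithLp.toLp 2 (Sum.elim (fun i => -jac u x a i) (Pi.single a 1))

theorem pd_apply {ι : Type*} [Fintype ι] {f : EuclideanSpace ℝ (Fin n) → EuclideanSpace ℝ ι}
    {x : EuclideanSpace ℝ (Fin n)} (hf : DifferentiableAt ℝ f x) (i : Fin n) (k : ι) :
    pd i f x k = pd i (fun y => f y k) x :=
  (pd_clm (EuclideanSpace.proj k : EuclideanSpace ℝ ι →L[ℝ] ℝ) hf i).symm

theorem contDiff_apply_coord {ι : Type*} [Fintype ι]
    {f : EuclideanSpace ℝ (Fin n) → EuclideanSpace ℝ ι} (hf : ContDiff ℝ ∞ f) (k : ι) :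
    ContDiff ℝ ∞ fun x => f x k :=
  contDiff_euclidean.1 hf k

theorem contDiff_jac (hu : ContDiff ℝ ∞ u) (a : Fin m) (i : Fin n) :
    ContDiff ℝ ∞ fun x => jac u x a i :=
  contDiff_pd (contDiff_apply_coord hu a) i

theorem contDiff_hess (hu : ContDiff ℝ ∞ u) (a : Fin m) (i j : Fin n) :
    ContDiff ℝ ∞ fun x => hess u a x i j :=
  contDiff_pd (contDiff_pd (contDiff_apply_coord hu a) j) i

theorem pd_jac (a : Fin m) (i j : Fin n) (x : EuclideanSpace ℝ (Fin n)) :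
    pd i (fun y => jac u y a j) x = hess u a x i j :=
  rfl

theorem hess_symm (hu : ContDiff ℝ ∞ u) (a : Fin m) (x : EuclideanSpace ℝ (Fin n))
    (i j : Fin n) : hess u a x i j = hess u a x j i :=
  pd_comm (contDiff_apply_coord hu a) i j x

theorem hess_transpose (hu : ContDiff ℝ ∞ u) (a : Fin m) (x : EuclideanSpace ℝ (Fin n)) :
    (hess u a x).transpose = hess u a x := by
  ext i j
  exact hess_symm hu a x j i

theorem graphMetric_apply (x : EuclideanSpace ℝ (Fin n)) (i j : Fin n) :
    graphMetric u x i j = (1 : Matrix _ _ ℝ) i j + ∑ a, jac u x a i * jac u x a j := by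
  simp [graphMetric, Matrix.mul_apply]

theorem contDiff_graphMetric (hu : ContDiff ℝ ∞ u) (i j : Fin n) :
    ContDiff ℝ ∞ fun x => graphMetric u x i j := by
  simp_rw [graphMetric_apply]
  exact contDiff_const.add
    (ContDiff.sum fun a _ => (contDiff_jac hu a i).mul (contDiff_jac hu a j))

theorem posDef_graphMetric (x : EuclideanSpace ℝ (Fin n)) : (graphMetric u x).PosDef := by
  rw [graphMetric, ← Matrix.conjTranspose_eq_transpose_of_trivial]
  exact Matrix.PosDef.one.add_posSemidef (Matrix.posSemidef_conjTranspose_mul_self _)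

theorem det_graphMetric_ne_zero (x : EuclideanSpace ℝ (Fin n)) : (graphMetric u x).det ≠ 0 :=
  (posDef_graphMetric x).det_pos.ne'

theorem isUnit_det_graphMetric (x : EuclideanSpace ℝ (Fin n)) : IsUnit (graphMetric u x).det :=
  isUnit_iff_ne_zero.2 (det_graphMetric_ne_zero x)

theorem graphMetric_transpose (x : EuclideanSpace ℝ (Fin n)) :
    (graphMetric u x).transpose = graphMetric u x := by
  simp [graphMetric, Matrix.transpose_mul]

theorem graphMetric_inv_transpose (x : EuclideanSpace ℝ (Fin n)) :
    (graphMetric u x)⁻¹.transpose = (graphMetric u x)⁻¹ := by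
  rw [Matrix.transpose_nonsing_inv, graphMetric_transpose]

theorem contDiff_graphMetric_inv (hu : ContDiff ℝ ∞ u) (i j : Fin n) :
    ContDiff ℝ ∞ fun x => (graphMetric u x)⁻¹ i j :=
  contDiff_inv_apply (contDiff_graphMetric hu) det_graphMetric_ne_zero i j

theorem contDiff_graphMap (hu : ContDiff ℝ ∞ u) : ContDiff ℝ ∞ (graphMap u) := by
  rw [contDiff_euclidean]
  rintro (i | a)
  · exact contDiff_apply_coord contDiff_id i
  · exact contDiff_apply_coord hu a

theorem contDiff_graphNormal (hu : ContDiff ℝ ∞ u) (a : Fin m) :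
    ContDiff ℝ ∞ (graphNormal u a) := by
  rw [contDiff_euclidean]
  rintro (i | b)
  · exact (contDiff_jac hu a i).neg
  · exact contDiff_const

theorem pd_graphMap (hu : ContDiff ℝ ∞ u) (i : Fin n) (x : EuclideanSpace ℝ (Fin n)) :
    pd i (graphMap u) x =
      WithLp.toLp 2 (Sum.elim (fun j => if j = i then 1 else 0) fun a => jac u x a i) := by
  have hd := (contDiff_graphMap hu).differentiable (by simp) x
  ext (j | a)
  · rw [pd_apply hd]
    exact pd_coord i j x
  · rw [pd_apply hd]
    rfl

theorem pd_pd_graphMap (hu : ContDiff ℝ ∞ u) (i j : Fin n) (x : EuclideanSpace ℝ (Fin n)) :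
    pd i (pd j (graphMap u)) x =
      WithLp.toLp 2 (Sum.elim (fun _ => 0) fun a => hess u a x i j) := by
  have hd := (contDiff_pd (contDiff_graphMap hu) j).differentiable (by simp) x
  ext (k | a)
  · rw [pd_apply hd]
    simp_rw [pd_graphMap hu]
    exact pd_const i _ x
  · rw [pd_apply hd]
    simp_rw [pd_graphMap hu]
    rfl

theorem pd_graphNormal (hu : ContDiff ℝ ∞ u) (a : Fin m) (i : Fin n)
    (x : EuclideanSpace ℝ (Fin n)) :
    pd i (graphNormal u a) x =
      WithLp.toLp 2 (Sum.elim (fun j => -hess u a x i j) fun _ => 0) := by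
  have hd := (contDiff_graphNormal hu a).differentiable (by simp) x
  ext (k | b)
  · rw [pd_apply hd]
    exact pd_neg _ _ _
  · rw [pd_apply hd]
    exact pd_const _ _ _

theorem inner_pd_graphMap (hu : ContDiff ℝ ∞ u) (i j : Fin n) (x : EuclideanSpace ℝ (Fin n)) :
    inner ℝ (pd i (graphMap u) x) (pd j (graphMap u) x) = graphMetric u x i j := by
  simp [pd_graphMap hu, graphMetric_apply, PiLp.inner_apply, Matrix.one_apply, mul_comm, eq_comm]

theorem inner_pd_graphMap_graphNormal (hu : ContDiff ℝ ∞ u) (i : Fin n) (a : Fin m)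
    (x : EuclideanSpace ℝ (Fin n)) :
    inner ℝ (pd i (graphMap u) x) (graphNormal u a x) = 0 := by
  simp [pd_graphMap hu, graphNormal, PiLp.inner_apply, Pi.single_apply]

theorem inner_pd_pd_graphMap_graphNormal (hu : ContDiff ℝ ∞ u) (i j : Fin n) (a : Fin m)
    (x : EuclideanSpace ℝ (Fin n)) :
    inner ℝ (pd i (pd j (graphMap u)) x) (graphNormal u a x) = hess u a x i j := by
  simp [pd_pd_graphMap hu, graphNormal, PiLp.inner_apply, Pi.single_apply]

theorem inner_pd_graphMap_pd_graphNormal (hu : ContDiff ℝ ∞ u) (i j : Fin n) (a : Fin m)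
    (x : EuclideanSpace ℝ (Fin n)) :
    inner ℝ (pd i (graphMap u) x) (pd j (graphNormal u a) x) = -hess u a x j i := by
  simp [pd_graphMap hu, pd_graphNormal hu, PiLp.inner_apply]

theorem inducedMetric_graphMap (hu : ContDiff ℝ ∞ u) (x : EuclideanSpace ℝ (Fin n)) :
    inducedMetric (graphMap u) x = graphMetric u x := by
  ext i j
  exact inner_pd_graphMap hu i j x

/-! ### Normal projection, the shrinker system and Ricci's equation. -/

variable {E : Type*} [NormedAddCommGroup E] [InnerProductSpace ℝ E]

theorem mem_normalSpace_iff {F : EuclideanSpace ℝ (Fin n) → E} {x : EuclideanSpace ℝ (Fin n)}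
    {v : E} : v ∈ normalSpace F x ↔ ∀ i, inner ℝ (pd i F x) v = 0 := by
  rw [normalSpace, Submodule.mem_orthogonal]
  constructor
  · exact fun h i => h _ ⟨_, rfl⟩
  · rintro h _ ⟨w, rfl⟩
    simp [fderiv_apply_eq_sum_pd, sum_inner, inner_smul_left, h]

theorem inner_normalPart [FiniteDimensional ℝ E] {F : EuclideanSpace ℝ (Fin n) → E}
    {x : EuclideanSpace ℝ (Fin n)} {ν : E} (hν : ν ∈ normalSpace F x) (v : E) :
    inner ℝ (normalPart F x v) ν = inner ℝ v ν := by
  rw [normalPart, Submodule.inner_starProjection_left_eq_right,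
    Submodule.starProjection_eq_self_iff.2 hν]

/-- A normal vector that differs from `v` by a tangent vector is the projection of `v`, so an
explicit candidate only has to be checked. -/
theorem normalPart_eq [FiniteDimensional ℝ E] {F : EuclideanSpace ℝ (Fin n) → E}
    {x : EuclideanSpace ℝ (Fin n)} {v w : E} {c : Fin n → ℝ} (hw : w ∈ normalSpace F x)
    (h : w = v + ∑ l, c l • pd l F x) : normalPart F x v = w := by
  refine Submodule.eq_starProjection_of_mem_orthogonal hw ?_
  have h1 : v - w = -∑ l, c l • pd l F x := by rw [h]; abel
  rw [h1]
  refine Submodule.neg_mem _ (Submodule.le_orthogonal_orthogonal _ ?_)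
  exact Submodule.sum_mem _ fun l _ => Submodule.smul_mem _ _ ⟨_, rfl⟩

theorem graphNormal_mem_normalSpace (hu : ContDiff ℝ ∞ u) (a : Fin m)
    (x : EuclideanSpace ℝ (Fin n)) : graphNormal u a x ∈ normalSpace (graphMap u) x :=
  mem_normalSpace_iff.2 fun i => inner_pd_graphMap_graphNormal hu i a x

/-- The self-shrinker equation as a quasilinear system for `u`. -/
theorem IsSelfShrinker.sum_inv_mul_hess (hs : IsSelfShrinker (graphMap u))
    (hu : ContDiff ℝ ∞ u) (a : Fin m) (x : EuclideanSpace ℝ (Fin n)) :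
    ∑ i, ∑ j, (graphMetric u x)⁻¹ i j * hess u a x i j = ∑ k, x k * jac u x a k - u x a := by
  -- Pairing with a normal vector removes every normal projection from the equation.
  have h := congrArg (fun v => inner ℝ v (graphNormal u a x)) (hs x)
  have hν := graphNormal_mem_normalSpace hu a x
  simp only [meanCurvature, inducedMetric_graphMap hu, sum_inner, inner_smul_left,
    secondFundamentalForm, inner_normalPart hν, inner_neg_left] at h
  have h2 : ∀ i j, inner ℝ (fderiv ℝ (fun y => coordTangent (graphMap u) y j) x
      (EuclideanSpace.single i 1)) (graphNormal u a x) = hess u a x i j :=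
    fun i j => inner_pd_pd_graphMap_graphNormal hu i j a x
  simp only [h2] at h
  rw [show (∑ i, ∑ j, (graphMetric u x)⁻¹ i j * hess u a x i j) = _ from h]
  simp [graphMap, graphNormal, PiLp.inner_apply, Pi.single_apply, mul_comm]
  ring

/-- The tangential products of `∂ⱼν_b` are `-∂ᵢ∂ⱼu^b`; raising the index with `g⁻¹` gives the
tangent vector that cancels them. Equality as functions allows a second differentiation. -/
theorem normalConnection_graphNormal (hu : ContDiff ℝ ∞ u) (b : Fin m) (j : Fin n) :
    normalConnection (graphMap u) (fun _ => EuclideanSpace.single j 1) (graphNormal u b) =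
      fun x => pd j (graphNormal u b) x +
        ∑ l, (∑ k, (graphMetric u x)⁻¹ l k * hess u b x k j) • pd l (graphMap u) x := by
  funext x
  refine normalPart_eq ?_ rfl
  rw [mem_normalSpace_iff]
  intro i
  simp only [inner_add_right, inner_sum, inner_smul_right, inner_pd_graphMap hu,
    inner_pd_graphMap_pd_graphNormal hu]
  have h := congrFun (congrFun (Matrix.mul_nonsing_inv_cancel_left _ (hess u b x)
    (isUnit_det_graphMetric (u := u) x)) i) j
  simp only [Matrix.mul_apply] at h
  rw [hess_symm hu b x j i, neg_add_eq_zero, ← h]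
  exact Finset.sum_congr rfl fun l _ => mul_comm _ _

/-- When the tangential correction is differentiated, derivatives of its coefficients stay tangent
and pair to zero with `ν_a`; only the second derivatives of the graph map survive. -/
theorem inner_normalConnection_normalConnection (hu : ContDiff ℝ ∞ u) (a b : Fin m) (i j : Fin n)
    (x : EuclideanSpace ℝ (Fin n)) :
    inner ℝ (normalConnection (graphMap u) (fun _ => EuclideanSpace.single i 1)
      (normalConnection (graphMap u) (fun _ => EuclideanSpace.single j 1) (graphNormal u b)) x)
      (graphNormal u a x) =
    inner ℝ (pd i (pd j (graphNormal u b)) x) (graphNormal u a x) +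
      (hess u a x * ((graphMetric u x)⁻¹ * hess u b x)) i j := by
  rw [normalConnection_graphNormal hu b j, normalConnection,
    inner_normalPart (graphNormal_mem_normalSpace hu a x)]
  have hc : ∀ l, DifferentiableAt ℝ
      (fun x => ∑ k, (graphMetric u x)⁻¹ l k * hess u b x k j) x := fun l =>
    (ContDiff.sum fun k _ =>
      (contDiff_graphMetric_inv hu l k).mul (contDiff_hess hu b k j)).differentiable (by simp) x
  have hF : ∀ l, DifferentiableAt ℝ (pd l (graphMap u)) x := fun l =>
    (contDiff_pd (contDiff_graphMap hu) l).differentiable (by simp) x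
  have hν : DifferentiableAt ℝ (pd j (graphNormal u b)) x :=
    (contDiff_pd (contDiff_graphNormal hu b) j).differentiable (by simp) x
  change inner ℝ (pd i _ x) _ = _
  rw [pd_add hν (DifferentiableAt.fun_sum fun l _ => (hc l).fun_smul (hF l)),
    pd_sum fun l _ => (hc l).fun_smul (hF l), inner_add_left, sum_inner]
  congr 1
  rw [Matrix.mul_apply]
  refine Finset.sum_congr rfl fun l _ => ?_
  rw [pd_smul (hc l) (hF l), inner_add_left, inner_smul_left, inner_smul_left,
    inner_pd_graphMap_graphNormal hu, inner_pd_pd_graphMap_graphNormal hu, Matrix.mul_apply]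
  simp [mul_comm]

/-- Ricci's equation: a flat normal bundle makes the shape operators commute. -/
theorem HasFlatNormalBundle.hess_mul_inv_mul_hess (hflat : HasFlatNormalBundle (graphMap u))
    (hu : ContDiff ℝ ∞ u) (a b : Fin m) (x : EuclideanSpace ℝ (Fin n)) :
    hess u a x * ((graphMetric u x)⁻¹ * hess u b x) =
      hess u b x * ((graphMetric u x)⁻¹ * hess u a x) := by
  -- Transposition exchanges `a` and `b`, so commutation amounts to symmetry in `i, j`, which is
  -- what the curvature of two coordinate fields measures.
  have hT : (hess u a x * ((graphMetric u x)⁻¹ * hess u b x)).transpose =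
      hess u b x * ((graphMetric u x)⁻¹ * hess u a x) := by
    simp only [Matrix.transpose_mul, hess_transpose hu, graphMetric_inv_transpose,
      Matrix.mul_assoc]
  rw [← hT]
  ext i j
  have h := hflat (fun _ => EuclideanSpace.single i 1) (fun _ => EuclideanSpace.single j 1)
    (graphNormal u b) contDiff_const contDiff_const (contDiff_graphNormal hu b)
    (graphNormal_mem_normalSpace hu b) x
  have h0 : normalConnection (graphMap u) (VectorField.lieBracket ℝ
      (fun _ => EuclideanSpace.single i 1) (fun _ => EuclideanSpace.single j 1))
      (graphNormal u b) x = 0 := by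
    simp [normalConnection, VectorField.lieBracket, normalPart]
  rw [normalCurvature, h0, sub_zero, sub_eq_zero] at h
  have h1 := congrArg (fun v => inner ℝ v (graphNormal u a x)) h
  simp only [inner_normalConnection_normalConnection hu] at h1
  rw [pd_comm (contDiff_graphNormal hu b) j i] at h1
  exact add_left_cancel h1

end Graph

/-! ### The weighted divergence form operator of a graphical self-shrinker -/

section Computation

open Matrix

variable {n m : ℕ} {u : EuclideanSpace ℝ (Fin n) → EuclideanSpace ℝ (Fin m)}

/-- The gradient `g^{ij} ∂ⱼuᵅ` of the component `uᵅ`. -/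
noncomputable def raisedJac (u : EuclideanSpace ℝ (Fin n) → EuclideanSpace ℝ (Fin m))
    (a : Fin m) (x : EuclideanSpace ℝ (Fin n)) : Fin n → ℝ :=
  (graphMetric u x)⁻¹ *ᵥ jac u x a

/-- The differential of `log √(det g)`. -/
noncomputable def logVolumeDeriv (u : EuclideanSpace ℝ (Fin n) → EuclideanSpace ℝ (Fin m))
    (x : EuclideanSpace ℝ (Fin n)) : Fin n → ℝ :=
  ∑ a, hess u a x *ᵥ raisedJac u a x

/-- The squared distance of the point `(x, u(x))` to the origin. -/
noncomputable def graphNormSq (u : EuclideanSpace ℝ (Fin n) → EuclideanSpace ℝ (Fin m))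
    (x : EuclideanSpace ℝ (Fin n)) : ℝ :=
  ∑ k, x k * x k + ∑ a, u x a * u x a

/-- Half of the differential of `graphNormSq`. -/
noncomputable def positionTangent (u : EuclideanSpace ℝ (Fin n) → EuclideanSpace ℝ (Fin m))
    (x : EuclideanSpace ℝ (Fin n)) : Fin n → ℝ :=
  x.ofLp + ∑ a, u x a • jac u x a

/-- The Gaussian weighted volume density. -/
noncomputable def gaussDensity (u : EuclideanSpace ℝ (Fin n) → EuclideanSpace ℝ (Fin m))
    (x : EuclideanSpace ℝ (Fin n)) : ℝ :=
  Real.sqrt (graphMetric u x).det * Real.exp (-(graphNormSq u x / 2))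

/-- The squared norm of the second fundamental form. -/
noncomputable def sffNormSq (u : EuclideanSpace ℝ (Fin n) → EuclideanSpace ℝ (Fin m))
    (x : EuclideanSpace ℝ (Fin n)) : ℝ :=
  ∑ a, ∑ b, ((1 : Matrix (Fin m) (Fin m) ℝ) a b - raisedJac u b x ⬝ᵥ jac u x a) *
    trace ((graphMetric u x)⁻¹ * hess u a x * ((graphMetric u x)⁻¹ * hess u b x))

/-- The inner product of covectors with respect to the metric of the graph. -/
noncomputable def coInner (u : EuclideanSpace ℝ (Fin n) → EuclideanSpace ℝ (Fin m))
    (x : EuclideanSpace ℝ (Fin n)) (v w : Fin n → ℝ) : ℝ :=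
  v ⬝ᵥ (graphMetric u x)⁻¹ *ᵥ w

theorem graphMetric_inv_symm (x : EuclideanSpace ℝ (Fin n)) (i j : Fin n) :
    (graphMetric u x)⁻¹ i j = (graphMetric u x)⁻¹ j i :=
  congrFun (congrFun (graphMetric_inv_transpose (u := u) x) j) i

theorem graphMetric_mulVec (x : EuclideanSpace ℝ (Fin n)) (v : Fin n → ℝ) :
    graphMetric u x *ᵥ v = v + ∑ a, (jac u x a ⬝ᵥ v) • jac u x a := by
  rw [graphMetric, add_mulVec, one_mulVec, ← mulVec_mulVec]
  congr 1
  ext i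
  simp [mulVec, dotProduct, mul_comm]

/-- This is `g⁻¹(g v) = v` written out. With `v = x` it reassembles the drift of the weighted
Laplacian. -/
theorem graphMetric_inv_mulVec_add (x : EuclideanSpace ℝ (Fin n)) (v : Fin n → ℝ) :
    (graphMetric u x)⁻¹ *ᵥ v + ∑ a, (jac u x a ⬝ᵥ v) • raisedJac u a x = v := by
  have h : (graphMetric u x)⁻¹ *ᵥ (graphMetric u x *ᵥ v) = v := by
    rw [mulVec_mulVec, nonsing_inv_mul _ (isUnit_det_graphMetric x), one_mulVec]
  conv_rhs => rw [← h, graphMetric_mulVec]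
  simp [mulVec_add, mulVec_sum, mulVec_smul, raisedJac]

theorem pd_graphMetric (hu : ContDiff ℝ ∞ u) (k p q : Fin n) (x : EuclideanSpace ℝ (Fin n)) :
    pd k (fun y => graphMetric u y p q) x =
      ∑ a, (hess u a x k p * jac u x a q + jac u x a p * hess u a x k q) := by
  have hd : ∀ a i, DifferentiableAt ℝ (fun y => jac u y a i) x :=
    fun a i => (contDiff_jac hu a i).differentiable (by simp) x
  simp_rw [graphMetric_apply]
  rw [pd_add (differentiableAt_const _)
    (DifferentiableAt.fun_sum fun a _ => (hd a p).fun_mul (hd a q)), pd_const, zero_add,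
    pd_sum fun a _ => (hd a p).fun_mul (hd a q)]
  exact Finset.sum_congr rfl fun a _ => pd_mul (hd a p) (hd a q) k

theorem pd_graphMetric_inv (hu : ContDiff ℝ ∞ u) (l i j : Fin n)
    (x : EuclideanSpace ℝ (Fin n)) :
    pd l (fun y => (graphMetric u y)⁻¹ i j) x =
      -∑ a, (((graphMetric u x)⁻¹ * hess u a x) i l * raisedJac u a x j +
        raisedJac u a x i * ((graphMetric u x)⁻¹ * hess u a x) j l) := by
  rw [pd_inv (contDiff_graphMetric hu) det_graphMetric_ne_zero]
  simp_rw [pd_graphMetric hu, Finset.mul_sum, Finset.sum_mul]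
  congr 1
  rw [Finset.sum_congr rfl fun p _ => Finset.sum_comm, Finset.sum_comm]
  refine Finset.sum_congr rfl fun a _ => ?_
  simp only [Matrix.mul_apply, raisedJac, mulVec, dotProduct, Finset.sum_mul_sum,
    ← Finset.sum_add_distrib]
  refine Finset.sum_congr rfl fun p _ => Finset.sum_congr rfl fun q _ => ?_
  rw [hess_symm hu a x l p, hess_symm hu a x l q, graphMetric_inv_symm x q j]
  ring

/-- In Jacobi's formula the two halves of `∂ₖg` contribute equally, whence the factor 2. This
justifies reading `logVolumeDeriv` as `d log √(det g)`. -/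
theorem pd_det_graphMetric (hu : ContDiff ℝ ∞ u) (k : Fin n) (x : EuclideanSpace ℝ (Fin n)) :
    pd k (fun y => (graphMetric u y).det) x =
      2 * (graphMetric u x).det * logVolumeDeriv u x k := by
  have hadj : ∀ i j, (graphMetric u x).adjugate i j =
      (graphMetric u x).det * (graphMetric u x)⁻¹ i j := by
    intro i j
    rw [inv_def, Ring.inverse_eq_inv', Matrix.smul_apply, smul_eq_mul,
      mul_inv_cancel_left₀ (det_graphMetric_ne_zero x)]
  rw [pd_det (contDiff_graphMetric hu)]
  simp_rw [pd_graphMetric hu, hadj, mul_assoc, ← Finset.mul_sum]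
  rw [mul_left_comm]
  congr 1
  have h1 : ∑ i, ∑ j, (graphMetric u x)⁻¹ i j *
      ∑ a, hess u a x k j * jac u x a i = logVolumeDeriv u x k := by
    simp only [logVolumeDeriv, raisedJac, Finset.sum_apply, mulVec, dotProduct, Finset.mul_sum]
    rw [Finset.sum_congr rfl fun p _ => Finset.sum_comm, Finset.sum_comm]
    refine Finset.sum_congr rfl fun a _ => ?_
    rw [Finset.sum_comm]
    refine Finset.sum_congr rfl fun p _ => Finset.sum_congr rfl fun q _ => ?_
    rw [graphMetric_inv_symm x p q]
    ring
  have h2 : ∑ i, ∑ j, (graphMetric u x)⁻¹ i j *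
      ∑ a, jac u x a j * hess u a x k i = logVolumeDeriv u x k := by
    rw [← h1, Finset.sum_comm]
    refine Finset.sum_congr rfl fun p _ => Finset.sum_congr rfl fun q _ => ?_
    rw [graphMetric_inv_symm x p q]
    simp only [mul_comm]
  simp_rw [Finset.sum_add_distrib, mul_add, Finset.sum_add_distrib, h1, h2]
  ring

theorem contDiff_graphNormSq (hu : ContDiff ℝ ∞ u) : ContDiff ℝ ∞ (graphNormSq u) :=
  (ContDiff.sum fun k _ =>
    (contDiff_apply_coord contDiff_id k).mul (contDiff_apply_coord contDiff_id k)).add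
  (ContDiff.sum fun a _ => (contDiff_apply_coord hu a).mul (contDiff_apply_coord hu a))

theorem pd_graphNormSq (hu : ContDiff ℝ ∞ u) (k : Fin n) (x : EuclideanSpace ℝ (Fin n)) :
    pd k (graphNormSq u) x = 2 * positionTangent u x k := by
  have h1 : ∀ i : Fin n, DifferentiableAt ℝ (fun y : EuclideanSpace ℝ (Fin n) => y i) x :=
    fun i => (contDiff_apply_coord contDiff_id i).differentiable (n := ∞) (by simp) x
  have h2 : ∀ a, DifferentiableAt ℝ (fun y => u y a) x :=
    fun a => (contDiff_apply_coord hu a).differentiable (by simp) x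
  have h3 : ∀ a, pd k (fun y => u y a) x = jac u x a k := fun a => rfl
  unfold graphNormSq
  rw [pd_add (DifferentiableAt.fun_sum fun i _ => (h1 i).fun_mul (h1 i))
    (DifferentiableAt.fun_sum fun a _ => (h2 a).fun_mul (h2 a)),
    pd_sum fun i _ => (h1 i).fun_mul (h1 i), pd_sum fun a _ => (h2 a).fun_mul (h2 a)]
  simp_rw [pd_mul (h1 _) (h1 _), pd_mul (h2 _) (h2 _), pd_coord, h3]
  simp only [positionTangent, Finset.sum_add_distrib, Pi.add_apply, Finset.sum_apply,
    Pi.smul_apply, smul_eq_mul, ite_mul, mul_ite, one_mul, mul_one, zero_mul, mul_zero,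
    Finset.sum_ite_eq', Finset.mem_univ, if_true, mul_comm (jac u x _ k)]
  ring

theorem contDiff_gaussDensity (hu : ContDiff ℝ ∞ u) : ContDiff ℝ ∞ (gaussDensity u) :=
  ((contDiff_det (contDiff_graphMetric hu)).sqrt det_graphMetric_ne_zero).mul
    ((contDiff_graphNormSq hu).div_const 2).neg.exp

theorem gaussDensity_pos (x : EuclideanSpace ℝ (Fin n)) : 0 < gaussDensity u x :=
  mul_pos (Real.sqrt_pos.2 (posDef_graphMetric x).det_pos) (Real.exp_pos _)

theorem pd_gaussDensity (hu : ContDiff ℝ ∞ u) (k : Fin n) (x : EuclideanSpace ℝ (Fin n)) :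
    pd k (gaussDensity u) x =
      gaussDensity u x * (logVolumeDeriv u x k - positionTangent u x k) := by
  have hdet : DifferentiableAt ℝ (fun y => (graphMetric u y).det) x :=
    (contDiff_det (contDiff_graphMetric hu)).differentiable (by simp) x
  have hs : DifferentiableAt ℝ (graphNormSq u) x :=
    (contDiff_graphNormSq hu).differentiable (by simp) x
  have hpos := (posDef_graphMetric (u := u) x).det_pos
  have he : HasDerivAt (fun t : ℝ => Real.exp (-(t / 2)))
      (Real.exp (-(graphNormSq u x / 2)) * (-(1 / 2))) (graphNormSq u x) :=
    ((hasDerivAt_id _).div_const 2).neg.exp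
  have hexp : DifferentiableAt ℝ (fun y => Real.exp (-(graphNormSq u y / 2))) x :=
    he.differentiableAt.comp x hs
  unfold gaussDensity
  rw [pd_mul (hdet.sqrt hpos.ne') hexp,
    pd_comp (Real.hasDerivAt_sqrt hpos.ne') hdet, pd_comp he hs, pd_det_graphMetric hu,
    pd_graphNormSq hu]
  have h := Real.mul_self_sqrt hpos.le
  have h0 := (Real.sqrt_pos.2 hpos).ne'
  -- Writing the determinant as `r * r` leaves a rational identity in `r`.
  set r := Real.sqrt (graphMetric u x).det
  rw [← h]
  field_simp
  ring

theorem trace_inv_mul_hess (hs : IsSelfShrinker (graphMap u)) (hu : ContDiff ℝ ∞ u)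
    (a : Fin m) (x : EuclideanSpace ℝ (Fin n)) :
    trace ((graphMetric u x)⁻¹ * hess u a x) = jac u x a ⬝ᵥ x.ofLp - u x a := by
  rw [dotProduct_comm]
  refine Eq.trans ?_ (hs.sum_inv_mul_hess hu a x)
  simp only [trace, diag_apply, Matrix.mul_apply]
  exact Finset.sum_congr rfl fun i _ => Finset.sum_congr rfl fun j _ => by
    rw [hess_symm hu a x j i]

/-- The drift collapses to `-x`. The volume term cancels half of `∂g⁻¹`; the other half is a trace
which the shrinker equation replaces by `x · Du^a - u^a`. Its `u^a` part cancels against the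
Gaussian factor, and `graphMetric_inv_mulVec_add` sums the rest. -/
theorem sum_pd_gaussDensity_mul_inv (hs : IsSelfShrinker (graphMap u)) (hu : ContDiff ℝ ∞ u)
    (j : Fin n) (x : EuclideanSpace ℝ (Fin n)) :
    ∑ i, pd i (fun y => gaussDensity u y * (graphMetric u y)⁻¹ i j) x =
      -(gaussDensity u x * x j) := by
  have hρ : DifferentiableAt ℝ (gaussDensity u) x :=
    (contDiff_gaussDensity hu).differentiable (by simp) x
  have hh : ∀ i, DifferentiableAt ℝ (fun y => (graphMetric u y)⁻¹ i j) x :=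
    fun i => (contDiff_graphMetric_inv hu i j).differentiable (by simp) x
  simp_rw [pd_mul hρ (hh _), pd_gaussDensity hu, pd_graphMetric_inv hu]
  rw [Finset.sum_add_distrib]
  have h1 : ∑ i, gaussDensity u x * (logVolumeDeriv u x i - positionTangent u x i) *
      (graphMetric u x)⁻¹ i j = gaussDensity u x *
        ((graphMetric u x)⁻¹ *ᵥ (logVolumeDeriv u x - positionTangent u x)) j := by
    simp only [mulVec, dotProduct, Finset.mul_sum, Pi.sub_apply]
    refine Finset.sum_congr rfl fun i _ => ?_
    rw [graphMetric_inv_symm x i j]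
    ring
  have h2 : ∑ i, gaussDensity u x * -∑ a, (((graphMetric u x)⁻¹ * hess u a x) i i *
      raisedJac u a x j + raisedJac u a x i * ((graphMetric u x)⁻¹ * hess u a x) j i) =
      gaussDensity u x * (-(∑ a, trace ((graphMetric u x)⁻¹ * hess u a x) • raisedJac u a x)
        - (graphMetric u x)⁻¹ *ᵥ logVolumeDeriv u x) j := by
    rw [← Finset.mul_sum, Finset.sum_neg_distrib, Finset.sum_comm]
    congr 1
    simp only [Finset.sum_add_distrib, logVolumeDeriv, mulVec_sum, mulVec_mulVec]
    simp only [mulVec, dotProduct, trace, diag_apply, Pi.sub_apply, Pi.neg_apply,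
      Finset.sum_apply, Pi.smul_apply, smul_eq_mul, Finset.sum_mul, neg_add, sub_eq_add_neg]
    refine congrArg₂ _ rfl (congrArg Neg.neg ?_)
    exact Finset.sum_congr rfl fun a _ => Finset.sum_congr rfl fun i _ => mul_comm _ _
  rw [h1, h2, ← mul_add, ← mul_neg]
  congr 1
  have hr : ∀ a, (graphMetric u x)⁻¹ *ᵥ jac u x a = raisedJac u a x := fun _ => rfl
  have h3 := congrFun (graphMetric_inv_mulVec_add (u := u) x x.ofLp) j
  simp only [trace_inv_mul_hess hs hu, positionTangent, mulVec_sub, mulVec_add, mulVec_sum,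
    mulVec_smul, sub_smul, Finset.sum_sub_distrib, hr, Pi.add_apply,
    Pi.sub_apply, Pi.neg_apply, Finset.sum_apply, Pi.smul_apply, smul_eq_mul] at h3 ⊢
  linarith

theorem contDiff_raisedJac (hu : ContDiff ℝ ∞ u) (a : Fin m) (i : Fin n) :
    ContDiff ℝ ∞ fun x => raisedJac u a x i := by
  simp only [raisedJac, mulVec, dotProduct]
  exact ContDiff.sum fun k _ => (contDiff_graphMetric_inv hu i k).mul (contDiff_jac hu a k)

theorem contDiff_logVolumeDeriv (hu : ContDiff ℝ ∞ u) (i : Fin n) :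
    ContDiff ℝ ∞ fun x => logVolumeDeriv u x i := by
  simp only [logVolumeDeriv, Finset.sum_apply, mulVec, dotProduct]
  exact ContDiff.sum fun a _ => ContDiff.sum fun k _ =>
    (contDiff_hess hu a i k).mul (contDiff_raisedJac hu a k)

theorem contDiff_positionTangent (hu : ContDiff ℝ ∞ u) (i : Fin n) :
    ContDiff ℝ ∞ fun x => positionTangent u x i := by
  simp only [positionTangent, Pi.add_apply, Finset.sum_apply, Pi.smul_apply]
  exact (contDiff_apply_coord contDiff_id i).add (ContDiff.sum fun a _ =>
    (contDiff_apply_coord hu a).smul (contDiff_jac hu a i))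

/-- The divergence of `ρ g^{ij} Yⱼ` for a one-form `Y`. -/
theorem sum_pd_flux (hs : IsSelfShrinker (graphMap u)) (hu : ContDiff ℝ ∞ u)
    {Y : EuclideanSpace ℝ (Fin n) → Fin n → ℝ} (hY : ∀ j, ContDiff ℝ ∞ fun x => Y x j)
    (x : EuclideanSpace ℝ (Fin n)) :
    ∑ i, pd i (fun y => gaussDensity u y * ((graphMetric u y)⁻¹ *ᵥ Y y) i) x =
      gaussDensity u x * (∑ i, ∑ j, (graphMetric u x)⁻¹ i j * pd i (fun y => Y y j) x
        - x.ofLp ⬝ᵥ Y x) := by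
  have hρh : ∀ i j, DifferentiableAt ℝ
      (fun y => gaussDensity u y * (graphMetric u y)⁻¹ i j) x := fun i j =>
    ((contDiff_gaussDensity hu).mul (contDiff_graphMetric_inv hu i j)).differentiable
      (by simp) x
  have hYd : ∀ j, DifferentiableAt ℝ (fun y => Y y j) x :=
    fun j => (hY j).differentiable (by simp) x
  have h1 : ∀ i, pd i (fun y => gaussDensity u y * ((graphMetric u y)⁻¹ *ᵥ Y y) i) x =
      ∑ j, (pd i (fun y => gaussDensity u y * (graphMetric u y)⁻¹ i j) x * Y x j +
        gaussDensity u x * ((graphMetric u x)⁻¹ i j * pd i (fun y => Y y j) x)) := by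
    intro i
    simp only [mulVec, dotProduct, Finset.mul_sum, ← mul_assoc]
    rw [pd_sum fun j _ => (hρh i j).fun_mul (hYd j)]
    exact Finset.sum_congr rfl fun j _ => pd_mul (hρh i j) (hYd j) i
  simp_rw [h1, Finset.sum_add_distrib, ← Finset.mul_sum]
  rw [Finset.sum_comm]
  simp_rw [← Finset.sum_mul, sum_pd_gaussDensity_mul_inv hs hu, dotProduct, mul_sub,
    Finset.mul_sum]
  rw [sub_eq_add_neg, ← Finset.sum_neg_distrib, add_comm]
  congr 1
  exact Finset.sum_congr rfl fun j _ => by ring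

end Computation

/-! ### The Bochner identity, and positivity of the quadratic forms in it. -/

section Bochner

open Matrix

variable {n m : ℕ} {u : EuclideanSpace ℝ (Fin n) → EuclideanSpace ℝ (Fin m)}

/-- The system of a graphical self-shrinker, differentiated once. -/
theorem sum_inv_mul_pd_hess (hs : IsSelfShrinker (graphMap u)) (hu : ContDiff ℝ ∞ u)
    (a : Fin m) (l : Fin n) (x : EuclideanSpace ℝ (Fin n)) :
    ∑ i, ∑ j, (graphMetric u x)⁻¹ i j * pd i (fun y => hess u a y j l) x =
      (hess u a x *ᵥ x.ofLp + (2 : ℝ) •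
        ∑ b, (hess u b x * ((graphMetric u x)⁻¹ * hess u a x)) *ᵥ raisedJac u b x) l := by
  have h0 : ∀ i j, DifferentiableAt ℝ (fun y => (graphMetric u y)⁻¹ i j) x :=
    fun i j => (contDiff_graphMetric_inv hu i j).differentiable (by simp) x
  have h1 : ∀ i j, DifferentiableAt ℝ (fun y => hess u a y i j) x :=
    fun i j => (contDiff_hess hu a i j).differentiable (by simp) x
  have h2 : ∀ i : Fin n, DifferentiableAt ℝ (fun y : EuclideanSpace ℝ (Fin n) => y i) x :=
    fun i => (contDiff_apply_coord contDiff_id i).differentiable (n := ∞) (by simp) x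
  have h3 : ∀ i, DifferentiableAt ℝ (fun y => jac u y a i) x :=
    fun i => (contDiff_jac hu a i).differentiable (by simp) x
  have h4 : DifferentiableAt ℝ (fun y => u y a) x :=
    (contDiff_apply_coord hu a).differentiable (by simp) x
  have hthird : ∀ i j, pd i (fun y => hess u a y j l) x = pd l (fun y => hess u a y i j) x := by
    intro i j
    have e : (fun y => hess u a y j l) = pd l (pd j fun y => u y a) :=
      funext fun y => hess_symm hu a y j l
    rw [e, pd_comm (contDiff_pd (contDiff_apply_coord hu a) j)]
    rfl
  have hpde := congrArg (fun f => pd l f x) (funext fun y => hs.sum_inv_mul_hess hu a y)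
  dsimp only at hpde
  rw [pd_sum fun i _ => DifferentiableAt.fun_sum fun j _ => (h0 i j).fun_mul (h1 i j),
    Finset.sum_congr rfl fun i _ => pd_sum (fun j _ => (h0 i j).fun_mul (h1 i j)) l,
    pd_sub (DifferentiableAt.fun_sum fun k _ => (h2 k).fun_mul (h3 k)) h4,
    pd_sum fun k _ => (h2 k).fun_mul (h3 k)] at hpde
  simp_rw [pd_mul (h0 _ _) (h1 _ _), pd_mul (h2 _) (h3 _), pd_coord, pd_jac,
    Finset.sum_add_distrib] at hpde
  have h5 : pd l (fun y => u y a) x = jac u x a l := rfl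
  -- By symmetry of the Hessian, both halves of `∂g⁻¹` give the same contraction.
  have h6 : ∑ i, ∑ j, pd l (fun y => (graphMetric u y)⁻¹ i j) x * hess u a x i j =
      -((2 : ℝ) • ∑ b, (hess u b x * ((graphMetric u x)⁻¹ * hess u a x)) *ᵥ
        raisedJac u b x) l := by
    have key : ∀ b, ∑ i, ∑ j, ((graphMetric u x)⁻¹ * hess u b x) i l * raisedJac u b x j *
        hess u a x i j =
        ((hess u b x * ((graphMetric u x)⁻¹ * hess u a x)) *ᵥ raisedJac u b x) l := by
      intro b
      have e1 : ∀ i, ((graphMetric u x)⁻¹ * hess u b x) i l =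
          (hess u b x * (graphMetric u x)⁻¹) l i := by
        intro i
        have : ((graphMetric u x)⁻¹ * hess u b x).transpose =
            hess u b x * (graphMetric u x)⁻¹ := by
          rw [transpose_mul, hess_transpose hu, graphMetric_inv_transpose]
        exact congrFun (congrFun this l) i
      simp_rw [e1]
      rw [← Matrix.mul_assoc, ← mulVec_mulVec]
      simp only [mulVec, dotProduct, Finset.mul_sum]
      exact Finset.sum_congr rfl fun i _ => Finset.sum_congr rfl fun j _ => by ring
    have key2 : ∀ b, ∑ i, ∑ j, raisedJac u b x i * ((graphMetric u x)⁻¹ * hess u b x) j l *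
        hess u a x i j =
        ((hess u b x * ((graphMetric u x)⁻¹ * hess u a x)) *ᵥ raisedJac u b x) l := by
      intro b
      rw [← key b, Finset.sum_comm]
      refine Finset.sum_congr rfl fun i _ => Finset.sum_congr rfl fun j _ => ?_
      rw [hess_symm hu a x j i]
      ring
    simp_rw [pd_graphMetric_inv hu, neg_mul, Finset.sum_mul, Finset.sum_neg_distrib, add_mul,
      Finset.sum_add_distrib]
    rw [Finset.sum_congr rfl fun i _ => Finset.sum_comm, Finset.sum_comm,
      Finset.sum_congr rfl fun b _ => key b,
      Finset.sum_congr rfl fun i _ => Finset.sum_comm (f := fun j b => raisedJac u b x i *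
        ((graphMetric u x)⁻¹ * hess u b x) j l * hess u a x i j), Finset.sum_comm,
      Finset.sum_congr rfl fun b _ => key2 b, ← two_mul]
    simp
  have h7 : (hess u a x *ᵥ x.ofLp) l = ∑ k, x k * hess u a x l k := by
    simp only [mulVec, dotProduct]
    exact Finset.sum_congr rfl fun k _ => mul_comm _ _
  -- Differentiating the coordinate in `x · Du^a` yields `∂ₗu^a`, which cancels `-∂ₗu^a`; only the
  -- Hessian applied to `x` remains.
  rw [h6, h5] at hpde
  simp_rw [hthird]
  rw [Pi.add_apply, h7]
  simp only [ite_mul, one_mul, zero_mul, Finset.sum_ite_eq', Finset.mem_univ, if_true] at hpde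
  linarith

theorem pd_raisedJac (hu : ContDiff ℝ ∞ u) (a : Fin m) (i l : Fin n)
    (x : EuclideanSpace ℝ (Fin n)) :
    pd i (fun y => raisedJac u a y l) x = ((graphMetric u x)⁻¹ * hess u a x) l i -
      ∑ b, ((raisedJac u b x ⬝ᵥ jac u x a) * ((graphMetric u x)⁻¹ * hess u b x) l i +
        raisedJac u b x l * (hess u b x *ᵥ raisedJac u a x) i) := by
  have h0 : ∀ i j, DifferentiableAt ℝ (fun y => (graphMetric u y)⁻¹ i j) x :=
    fun i j => (contDiff_graphMetric_inv hu i j).differentiable (by simp) x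
  have h3 : ∀ i, DifferentiableAt ℝ (fun y => jac u y a i) x :=
    fun i => (contDiff_jac hu a i).differentiable (by simp) x
  have e : (fun y => raisedJac u a y l) =
      fun y => ∑ k, (graphMetric u y)⁻¹ l k * jac u y a k := rfl
  rw [e, pd_sum fun k _ => (h0 l k).fun_mul (h3 k)]
  simp_rw [pd_mul (h0 l _) (h3 _), pd_jac, pd_graphMetric_inv hu, neg_mul, Finset.sum_mul]
  rw [Finset.sum_add_distrib, Finset.sum_neg_distrib, Finset.sum_comm, neg_add_eq_sub]
  congr 1
  · rw [Matrix.mul_apply]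
    exact Finset.sum_congr rfl fun k _ => by rw [hess_symm hu a x i k]
  · refine Finset.sum_congr rfl fun b _ => ?_
    simp_rw [add_mul]
    rw [Finset.sum_add_distrib]
    congr 1
    · rw [dotProduct, Finset.sum_mul]
      exact Finset.sum_congr rfl fun k _ => by ring
    · simp_rw [mul_assoc]
      rw [← Finset.mul_sum]
      congr 1
      simp only [mulVec, dotProduct, raisedJac, Matrix.mul_apply, Finset.mul_sum, Finset.sum_mul]
      rw [Finset.sum_comm]
      refine Finset.sum_congr rfl fun p _ => Finset.sum_congr rfl fun k _ => ?_
      rw [hess_symm hu b x p i, graphMetric_inv_symm x k p]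
      ring

theorem coInner_mulVec_mulVec (hu : ContDiff ℝ ∞ u) (a b : Fin m)
    (x : EuclideanSpace ℝ (Fin n)) (v w : Fin n → ℝ) :
    coInner u x (hess u a x *ᵥ v) (hess u b x *ᵥ w) =
      v ⬝ᵥ (hess u a x * ((graphMetric u x)⁻¹ * hess u b x)) *ᵥ w := by
  rw [coInner, dotProduct_comm, dotProduct_mulVec, ← mulVec_transpose, hess_transpose hu,
    dotProduct_comm]
  simp only [mulVec_mulVec]

/-- The Bochner type identity for `log √(det g)` on a graphical self-shrinker whose shape operators
commute. -/
theorem sum_inv_mul_pd_logVolumeDeriv (hs : IsSelfShrinker (graphMap u)) (hu : ContDiff ℝ ∞ u)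
    (x : EuclideanSpace ℝ (Fin n))
    (hcomm : ∀ a b, hess u a x * ((graphMetric u x)⁻¹ * hess u b x) =
      hess u b x * ((graphMetric u x)⁻¹ * hess u a x)) :
    ∑ i, ∑ j, (graphMetric u x)⁻¹ i j * pd i (fun y => logVolumeDeriv u y j) x
        - x.ofLp ⬝ᵥ logVolumeDeriv u x =
      sffNormSq u x + coInner u x (logVolumeDeriv u x) (logVolumeDeriv u x) := by
  have h1 : ∀ a i j, DifferentiableAt ℝ (fun y => hess u a y i j) x :=
    fun a i j => (contDiff_hess hu a i j).differentiable (by simp) x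
  have h2 : ∀ a i, DifferentiableAt ℝ (fun y => raisedJac u a y i) x :=
    fun a i => (contDiff_raisedJac hu a i).differentiable (by simp) x
  have e : ∀ i j, pd i (fun y => logVolumeDeriv u y j) x = ∑ a, ∑ l,
      (pd i (fun y => hess u a y j l) x * raisedJac u a x l +
        hess u a x j l * pd i (fun y => raisedJac u a y l) x) := by
    intro i j
    have e0 : (fun y => logVolumeDeriv u y j) =
        fun y => ∑ a, ∑ l, hess u a y j l * raisedJac u a y l := by
      funext y
      simp only [logVolumeDeriv, Finset.sum_apply, mulVec, dotProduct]
    rw [e0, pd_sum fun a _ => DifferentiableAt.fun_sum fun l _ => (h1 a j l).fun_mul (h2 a l)]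
    refine Finset.sum_congr rfl fun a _ => ?_
    rw [pd_sum fun l _ => (h1 a j l).fun_mul (h2 a l)]
    exact Finset.sum_congr rfl fun l _ => pd_mul (h1 a j l) (h2 a l) i
  set q : ℝ := coInner u x (logVolumeDeriv u x) (logVolumeDeriv u x) with hq
  have hq1 : ∑ a, ∑ b, raisedJac u a x ⬝ᵥ
      (hess u a x * ((graphMetric u x)⁻¹ * hess u b x)) *ᵥ raisedJac u b x = q := by
    simp_rw [← coInner_mulVec_mulVec hu]
    simp only [hq, logVolumeDeriv, coInner, mulVec_sum, sum_dotProduct, dotProduct_sum]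
    exact Finset.sum_comm
  -- The only use of commutation: the contraction produced by the computation has the indices
  -- crossed, while `|∇w|²` has them in order.
  have hq2 : ∑ a, ∑ b, raisedJac u a x ⬝ᵥ
      (hess u b x * ((graphMetric u x)⁻¹ * hess u a x)) *ᵥ raisedJac u b x = q := by
    rw [← hq1]
    exact Finset.sum_congr rfl fun a _ => Finset.sum_congr rfl fun b _ => by rw [hcomm b a]
  have hA : ∀ a, ∑ i, ∑ j, (graphMetric u x)⁻¹ i j *
      ∑ l, pd i (fun y => hess u a y j l) x * raisedJac u a x l =
      x.ofLp ⬝ᵥ hess u a x *ᵥ raisedJac u a x + 2 * ∑ b, raisedJac u a x ⬝ᵥ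
        (hess u b x * ((graphMetric u x)⁻¹ * hess u a x)) *ᵥ raisedJac u b x := by
    intro a
    have t1 : x.ofLp ⬝ᵥ hess u a x *ᵥ raisedJac u a x =
        raisedJac u a x ⬝ᵥ hess u a x *ᵥ x.ofLp := by
      rw [dotProduct_mulVec, ← mulVec_transpose, hess_transpose hu, dotProduct_comm]
    rw [t1, ← dotProduct_sum, ← smul_eq_mul, ← dotProduct_smul, ← dotProduct_add]
    simp_rw [Finset.mul_sum]
    rw [Finset.sum_congr rfl fun i _ => Finset.sum_comm, Finset.sum_comm]
    conv_rhs => rw [dotProduct]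
    refine Finset.sum_congr rfl fun l _ => ?_
    rw [← sum_inv_mul_pd_hess hs hu]
    simp_rw [Finset.mul_sum]
    exact Finset.sum_congr rfl fun i _ => Finset.sum_congr rfl fun j _ => by ring
  have htr : ∀ a b, ∑ i, ∑ j, (graphMetric u x)⁻¹ i j *
      ∑ l, hess u a x j l * ((graphMetric u x)⁻¹ * hess u b x) l i =
      trace ((graphMetric u x)⁻¹ * hess u a x * ((graphMetric u x)⁻¹ * hess u b x)) := by
    intro a b
    rw [Matrix.mul_assoc]
    simp only [trace, diag_apply]
    refine Finset.sum_congr rfl fun i _ => ?_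
    rw [Matrix.mul_apply]
    exact Finset.sum_congr rfl fun j _ => by rw [Matrix.mul_apply]
  have hB : ∀ a, ∑ i, ∑ j, (graphMetric u x)⁻¹ i j *
      ∑ l, hess u a x j l * pd i (fun y => raisedJac u a y l) x =
      ∑ b, (((1 : Matrix (Fin m) (Fin m) ℝ) a b - raisedJac u b x ⬝ᵥ jac u x a) *
        trace ((graphMetric u x)⁻¹ * hess u a x * ((graphMetric u x)⁻¹ * hess u b x)) -
        raisedJac u a x ⬝ᵥ
          (hess u b x * ((graphMetric u x)⁻¹ * hess u a x)) *ᵥ raisedJac u b x) := by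
    intro a
    simp_rw [← coInner_mulVec_mulVec hu, sub_mul, Finset.sum_sub_distrib, Matrix.one_apply,
      ite_mul, one_mul, zero_mul, Finset.sum_ite_eq, Finset.mem_univ, if_true,
      pd_raisedJac hu, mul_sub, Finset.sum_sub_distrib, mul_sub, Finset.sum_sub_distrib, htr]
    rw [sub_sub]
    congr 1
    rw [← Finset.sum_add_distrib]
    simp_rw [Finset.mul_sum]
    rw [Finset.sum_congr rfl fun i _ => Finset.sum_congr rfl fun j _ => Finset.sum_comm,
      Finset.sum_congr rfl fun i _ => Finset.sum_comm, Finset.sum_comm]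
    refine Finset.sum_congr rfl fun b _ => ?_
    rw [← htr, coInner]
    simp only [mulVec, dotProduct, Finset.mul_sum]
    rw [← Finset.sum_add_distrib]
    refine Finset.sum_congr rfl fun i _ => ?_
    rw [← Finset.sum_add_distrib]
    refine Finset.sum_congr rfl fun j _ => ?_
    rw [← Finset.sum_add_distrib]
    refine Finset.sum_congr rfl fun l _ => ?_
    rw [← Finset.mul_sum]
    ring
  have hsum : ∑ i, ∑ j, (graphMetric u x)⁻¹ i j * pd i (fun y => logVolumeDeriv u y j) x =
      ∑ a, ((∑ i, ∑ j, (graphMetric u x)⁻¹ i j *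
        ∑ l, pd i (fun y => hess u a y j l) x * raisedJac u a x l) +
      ∑ i, ∑ j, (graphMetric u x)⁻¹ i j *
        ∑ l, hess u a x j l * pd i (fun y => raisedJac u a y l) x) := by
    simp_rw [e, ← Finset.sum_add_distrib, ← mul_add, ← Finset.sum_add_distrib]
    rw [Finset.sum_comm (s := (Finset.univ : Finset (Fin m)))]
    refine Finset.sum_congr rfl fun i _ => ?_
    rw [Finset.sum_comm (s := (Finset.univ : Finset (Fin m)))]
    exact Finset.sum_congr rfl fun j _ => Finset.mul_sum _ _ _
  have hx : x.ofLp ⬝ᵥ logVolumeDeriv u x =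
      ∑ a, x.ofLp ⬝ᵥ hess u a x *ᵥ raisedJac u a x := by
    rw [logVolumeDeriv, dotProduct_sum]
  rw [hsum, hx]
  -- The differentiated system contributes `2q` and the derivative of `raisedJac` contributes `-q`.
  simp_rw [hA, hB, Finset.sum_add_distrib, Finset.sum_sub_distrib, ← Finset.mul_sum, hq2]
  rw [sffNormSq]
  ring

/-- The drift Laplacian of the squared distance to the origin, halved. -/
theorem sum_inv_mul_pd_positionTangent (hs : IsSelfShrinker (graphMap u)) (hu : ContDiff ℝ ∞ u)
    (x : EuclideanSpace ℝ (Fin n)) :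
    ∑ i, ∑ j, (graphMetric u x)⁻¹ i j * pd i (fun y => positionTangent u y j) x
        - x.ofLp ⬝ᵥ positionTangent u x = n - graphNormSq u x := by
  have h2 : ∀ i : Fin n, DifferentiableAt ℝ (fun y : EuclideanSpace ℝ (Fin n) => y i) x :=
    fun i => (contDiff_apply_coord contDiff_id i).differentiable (n := ∞) (by simp) x
  have h3 : ∀ a i, DifferentiableAt ℝ (fun y => jac u y a i) x :=
    fun a i => (contDiff_jac hu a i).differentiable (by simp) x
  have h4 : ∀ a, DifferentiableAt ℝ (fun y => u y a) x :=
    fun a => (contDiff_apply_coord hu a).differentiable (by simp) x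
  have h5 : ∀ a i, pd i (fun y => u y a) x = jac u x a i := fun a i => rfl
  have e : ∀ i j, pd i (fun y => positionTangent u y j) x =
      graphMetric u x j i + ∑ a, u x a * hess u a x j i := by
    intro i j
    have e0 : (fun y => positionTangent u y j) =
        fun y => y j + ∑ a, u y a * jac u y a j := by
      funext y
      simp [positionTangent]
    rw [e0, pd_add (h2 j) (DifferentiableAt.fun_sum fun a _ => (h4 a).fun_mul (h3 a j)),
      pd_sum fun a _ => (h4 a).fun_mul (h3 a j), pd_coord, graphMetric_apply,
      Matrix.one_apply, add_assoc, ← Finset.sum_add_distrib]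
    congr 1
    refine Finset.sum_congr rfl fun a _ => ?_
    rw [pd_mul (h4 a) (h3 a j), h5, pd_jac, hess_symm hu a x i j]
    ring
  have h6 : ∑ i, ∑ j, (graphMetric u x)⁻¹ i j * graphMetric u x j i = n := by
    have := congrArg trace (nonsing_inv_mul _ (isUnit_det_graphMetric (u := u) x))
    rw [trace_one, Fintype.card_fin] at this
    rw [← this]
    simp only [trace, diag_apply, Matrix.mul_apply]
  have h7 : ∑ i, ∑ j, (graphMetric u x)⁻¹ i j * ∑ a, u x a * hess u a x j i =
      ∑ a, u x a * (jac u x a ⬝ᵥ x.ofLp - u x a) := by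
    simp_rw [← trace_inv_mul_hess hs hu, Finset.mul_sum, trace, diag_apply, Matrix.mul_apply,
      Finset.mul_sum]
    rw [Finset.sum_congr rfl fun i _ => Finset.sum_comm, Finset.sum_comm]
    exact Finset.sum_congr rfl fun a _ => Finset.sum_congr rfl fun i _ =>
      Finset.sum_congr rfl fun j _ => by ring
  simp_rw [e, mul_add, Finset.sum_add_distrib, h6, h7, positionTangent, dotProduct_add,
    dotProduct_sum, dotProduct_smul, dotProduct_comm x.ofLp (jac u x _), graphNormSq, mul_sub,
    Finset.sum_sub_distrib, smul_eq_mul]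
  simp only [dotProduct]
  ring

theorem graphMetric_mulVec_inv_mulVec (x : EuclideanSpace ℝ (Fin n)) (v : Fin n → ℝ) :
    graphMetric u x *ᵥ ((graphMetric u x)⁻¹ *ᵥ v) = v := by
  rw [mulVec_mulVec, mul_nonsing_inv _ (isUnit_det_graphMetric x), one_mulVec]

/-- With `y = g⁻¹v`, the right side is the squared length of the ambient tangent vector `(y, Du y)`.
-/
theorem coInner_self_eq (x : EuclideanSpace ℝ (Fin n)) (v : Fin n → ℝ) :
    coInner u x v v =
      ((graphMetric u x)⁻¹ *ᵥ v) ⬝ᵥ ((graphMetric u x)⁻¹ *ᵥ v) +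
        ∑ a, (jac u x a ⬝ᵥ (graphMetric u x)⁻¹ *ᵥ v) ^ 2 := by
  conv_lhs => rw [coInner]; arg 1; rw [← graphMetric_mulVec_inv_mulVec (u := u) x v,
    graphMetric_mulVec]
  rw [add_dotProduct, sum_dotProduct]
  simp only [smul_dotProduct, smul_eq_mul, pow_two]

theorem coInner_self_nonneg (x : EuclideanSpace ℝ (Fin n)) (v : Fin n → ℝ) :
    0 ≤ coInner u x v v := by
  rw [coInner_self_eq]
  exact add_nonneg (Finset.sum_nonneg fun i _ => mul_self_nonneg _)
    (Finset.sum_nonneg fun a _ => sq_nonneg _)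

/-- The tangential part of the position vector is at most as long as the position vector. -/
theorem coInner_positionTangent_le (x : EuclideanSpace ℝ (Fin n)) :
    coInner u x (positionTangent u x) (positionTangent u x) ≤ graphNormSq u x := by
  have h1 := coInner_self_eq (u := u) x (positionTangent u x)
  set y := (graphMetric u x)⁻¹ *ᵥ positionTangent u x with hy
  have h2 : coInner u x (positionTangent u x) (positionTangent u x) =
      x.ofLp ⬝ᵥ y + ∑ a, u x a * (jac u x a ⬝ᵥ y) := by
    rw [coInner, ← hy]
    simp [positionTangent, add_dotProduct, sum_dotProduct, smul_dotProduct]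
  -- Together with `h4` this is `|X - (y, Du y)|² ≥ 0`, where `(y, Du y)` is the tangential part of
  -- `X`.
  have h3 : 0 ≤ (x.ofLp - y) ⬝ᵥ (x.ofLp - y) := Finset.sum_nonneg fun i _ => mul_self_nonneg _
  have h4 : 0 ≤ ∑ a, (u x a - jac u x a ⬝ᵥ y) ^ 2 := Finset.sum_nonneg fun a _ => sq_nonneg _
  have h5 : graphNormSq u x = x.ofLp ⬝ᵥ x.ofLp + ∑ a, u x a ^ 2 := by
    simp [graphNormSq, dotProduct, pow_two]
  simp only [sub_dotProduct, dotProduct_sub, dotProduct_comm y x.ofLp] at h3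
  simp only [sub_sq, Finset.sum_add_distrib, Finset.sum_sub_distrib, mul_assoc,
    ← Finset.mul_sum] at h4
  linarith

/-- The inverse metric of the normal bundle is positive definite. -/
theorem sum_normalMetric_eq (x : EuclideanSpace ℝ (Fin n)) (v : Fin m → ℝ) :
    ∑ a, ∑ b, ((1 : Matrix (Fin m) (Fin m) ℝ) a b - raisedJac u b x ⬝ᵥ jac u x a) *
      (v a * v b) =
      (∑ a, v a • raisedJac u a x) ⬝ᵥ (∑ a, v a • raisedJac u a x) +
        ∑ a, (v a - jac u x a ⬝ᵥ ∑ b, v b • raisedJac u b x) ^ 2 := by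
  -- The right side of the goal is the squared length of the normal projection of `(0, v)`, whose
  -- tangential part is determined by `g⁻¹` of this covector.
  have h1 := coInner_self_eq (u := u) x (∑ a, v a • jac u x a)
  have hy : (graphMetric u x)⁻¹ *ᵥ (∑ a, v a • jac u x a) = ∑ a, v a • raisedJac u a x := by
    simp only [mulVec_sum, mulVec_smul, raisedJac]
  have h2 : coInner u x (∑ a, v a • jac u x a) (∑ a, v a • jac u x a) =
      ∑ a, v a * (jac u x a ⬝ᵥ ∑ b, v b • raisedJac u b x) := by
    rw [coInner, hy, sum_dotProduct]
    simp only [smul_dotProduct, smul_eq_mul]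
  have h3 : ∑ a, ∑ b, (raisedJac u b x ⬝ᵥ jac u x a) * (v a * v b) =
      ∑ a, v a * (jac u x a ⬝ᵥ ∑ b, v b • raisedJac u b x) := by
    refine Finset.sum_congr rfl fun a _ => ?_
    rw [dotProduct_sum, Finset.mul_sum]
    refine Finset.sum_congr rfl fun b _ => ?_
    rw [dotProduct_smul, dotProduct_comm, smul_eq_mul]
    ring
  have h4 : ∑ a, ∑ b, (1 : Matrix (Fin m) (Fin m) ℝ) a b * (v a * v b) = ∑ a, v a ^ 2 := by
    simp [Matrix.one_apply, pow_two]
  rw [hy] at h1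
  simp_rw [sub_mul, Finset.sum_sub_distrib, h3, h4]
  set y := ∑ a, v a • raisedJac u a x
  simp only [sub_sq, Finset.sum_add_distrib, Finset.sum_sub_distrib, mul_assoc,
    ← Finset.mul_sum]
  linarith

theorem sum_normalMetric_nonneg (x : EuclideanSpace ℝ (Fin n)) (v : Fin m → ℝ) :
    0 ≤ ∑ a, ∑ b, ((1 : Matrix (Fin m) (Fin m) ℝ) a b - raisedJac u b x ⬝ᵥ jac u x a) *
      (v a * v b) := by
  rw [sum_normalMetric_eq]
  exact add_nonneg (Finset.sum_nonneg fun i _ => mul_self_nonneg _)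
    (Finset.sum_nonneg fun a _ => sq_nonneg _)

theorem eq_zero_of_sum_normalMetric_eq_zero (x : EuclideanSpace ℝ (Fin n)) (v : Fin m → ℝ)
    (h : ∑ a, ∑ b, ((1 : Matrix (Fin m) (Fin m) ℝ) a b - raisedJac u b x ⬝ᵥ jac u x a) *
      (v a * v b) = 0) : v = 0 := by
  rw [sum_normalMetric_eq] at h
  obtain ⟨h1, h2⟩ := (add_eq_zero_iff_of_nonneg
    (Finset.sum_nonneg fun i _ => mul_self_nonneg _)
    (Finset.sum_nonneg fun a _ => sq_nonneg _)).1 h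
  rw [dotProduct_self_eq_zero.1 h1] at h2
  funext a
  have := (Finset.sum_eq_zero_iff_of_nonneg fun a _ => sq_nonneg _).1 h2 a (Finset.mem_univ a)
  simpa using this

/-- Factoring `g⁻¹ = BᵀB` turns the traces into entrywise products of the symmetric matrices `B
(D²u^a) Bᵀ`. Thus `|B|²` is a sum over entries of the positive definite form `δ_ab - ⟨du^a, du^b⟩`,
the inverse Gram matrix of the frame `graphNormal`. -/
theorem exists_sffNormSq_eq (hu : ContDiff ℝ ∞ u) (x : EuclideanSpace ℝ (Fin n)) :
    ∃ (k : ℕ) (B : Matrix (Fin k) (Fin n) ℝ), (graphMetric u x)⁻¹ = B.transpose * B ∧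
      sffNormSq u x = ∑ i, ∑ j, ∑ a, ∑ b,
        ((1 : Matrix (Fin m) (Fin m) ℝ) a b - raisedJac u b x ⬝ᵥ jac u x a) *
        ((B * hess u a x * B.transpose) i j * (B * hess u b x * B.transpose) i j) := by
  obtain ⟨k, v, hv⟩ := posSemidef_iff_eq_sum_vecMulVec.1
    (posDef_graphMetric (u := u) x).inv.posSemidef
  have hB : (graphMetric u x)⁻¹ = (Matrix.of v).transpose * Matrix.of v := by
    rw [hv]
    ext i j
    simp [Matrix.mul_apply, Matrix.sum_apply, vecMulVec_apply]
  refine ⟨k, Matrix.of v, hB, ?_⟩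
  generalize Matrix.of v = B at hB
  have htr : ∀ a b, trace ((graphMetric u x)⁻¹ * hess u a x *
      ((graphMetric u x)⁻¹ * hess u b x)) =
      ∑ i, ∑ j, (B * hess u a x * B.transpose) i j * (B * hess u b x * B.transpose) i j := by
    intro a b
    have hT : (B * hess u b x * B.transpose).transpose = B * hess u b x * B.transpose := by
      simp only [transpose_mul, transpose_transpose, hess_transpose hu, Matrix.mul_assoc]
    have h1 : ∑ i, ∑ j, (B * hess u a x * B.transpose) i j *
        (B * hess u b x * B.transpose) i j =
        trace (B * hess u a x * B.transpose * (B * hess u b x * B.transpose)) := by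
      conv_rhs => rw [← hT]
      simp only [trace, diag_apply, Matrix.mul_apply (N := Matrix.transpose _)]
      rfl
    rw [h1, hB]
    simp only [Matrix.mul_assoc]
    rw [trace_mul_comm]
    simp only [Matrix.mul_assoc]
  unfold sffNormSq
  simp_rw [htr, Finset.mul_sum]
  rw [Finset.sum_congr rfl fun a _ => Finset.sum_comm, Finset.sum_comm]
  refine Finset.sum_congr rfl fun i _ => ?_
  rw [Finset.sum_congr rfl fun a _ => Finset.sum_comm, Finset.sum_comm]

theorem sffNormSq_nonneg (hu : ContDiff ℝ ∞ u) (x : EuclideanSpace ℝ (Fin n)) :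
    0 ≤ sffNormSq u x := by
  obtain ⟨k, B, -, h⟩ := exists_sffNormSq_eq hu x
  rw [h]
  exact Finset.sum_nonneg fun i _ => Finset.sum_nonneg fun j _ =>
    sum_normalMetric_nonneg x fun a => (B * hess u a x * B.transpose) i j

theorem hess_eq_zero_of_sffNormSq_eq_zero (hu : ContDiff ℝ ∞ u)
    {x : EuclideanSpace ℝ (Fin n)} (h : sffNormSq u x = 0) (a : Fin m) : hess u a x = 0 := by
  obtain ⟨k, B, hB, h'⟩ := exists_sffNormSq_eq hu x
  rw [h'] at h
  have h1 : B * hess u a x * B.transpose = 0 := by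
    ext i j
    have h2 := (Finset.sum_eq_zero_iff_of_nonneg fun i _ => Finset.sum_nonneg fun j _ =>
      sum_normalMetric_nonneg x fun a => (B * hess u a x * B.transpose) i j).1 h i
      (Finset.mem_univ i)
    have h3 := (Finset.sum_eq_zero_iff_of_nonneg fun j _ =>
      sum_normalMetric_nonneg x fun a => (B * hess u a x * B.transpose) i j).1 h2 j
      (Finset.mem_univ j)
    exact congrFun (eq_zero_of_sum_normalMetric_eq_zero x
      (fun a => (B * hess u a x * B.transpose) i j) h3) a
  -- `B` need not be square, so it is not cancelled directly; `Bᵀ · B` on the outside restores the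
  -- invertible `g⁻¹`.
  have h2 : (graphMetric u x)⁻¹ * hess u a x * (graphMetric u x)⁻¹ = 0 := by
    have := congrArg (fun M => B.transpose * M * B) h1
    simpa [hB, Matrix.mul_assoc] using this
  have hdet := isUnit_det_graphMetric (u := u) x
  have h3 := congrArg (fun M => graphMetric u x * M * graphMetric u x) h2
  simpa [Matrix.mul_assoc, nonsing_inv_mul _ hdet, mul_nonsing_inv_cancel_left _ _ hdet] using h3

end Bochner

/-! ### Integral estimates -/

section Integration

open Matrix MeasureTheory

variable {n m : ℕ} {u : EuclideanSpace ℝ (Fin n) → EuclideanSpace ℝ (Fin m)}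

theorem hasDerivAt_max_sq (t : ℝ) : HasDerivAt (fun t : ℝ => max 0 t ^ 2) (2 * max 0 t) t := by
  rcases lt_trichotomy t 0 with h | rfl | h
  · rw [max_eq_left h.le, mul_zero]
    refine (hasDerivAt_const t (0 : ℝ)).congr_of_eventuallyEq ?_
    filter_upwards [gt_mem_nhds h] with y hy
    rw [max_eq_left hy.le]
    norm_num
  -- At the corner the function is dominated by `t²`, hence is `o(t)`.
  · rw [max_self, mul_zero, hasDerivAt_iff_isLittleO_nhds_zero]
    refine Asymptotics.IsBigO.trans_isLittleO (g := fun t : ℝ => t ^ 2) ?_ ?_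
    · refine Asymptotics.isBigO_of_le _ fun y => ?_
      simp only [zero_add, max_self, smul_zero, sub_zero, norm_pow, Real.norm_eq_abs, ne_eq,
        OfNat.ofNat_ne_zero, not_false_eq_true, zero_pow]
      refine pow_le_pow_left₀ (abs_nonneg _) ?_ 2
      rw [abs_of_nonneg (le_max_left _ _)]
      exact max_le (abs_nonneg _) (le_abs_self _)
    · exact Asymptotics.isLittleO_pow_id one_lt_two
  · rw [max_eq_right h.le]
    have := hasDerivAt_pow 2 t
    simp only [Nat.cast_ofNat, Nat.add_one_sub_one, pow_one] at this
    refine this.congr_of_eventuallyEq ?_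
    filter_upwards [lt_mem_nhds h] with y hy
    rw [max_eq_right hy.le]

theorem contDiff_max_sq : ContDiff ℝ 1 (fun t : ℝ => max 0 t ^ 2) := by
  rw [contDiff_one_iff_deriv]
  refine ⟨fun t => (hasDerivAt_max_sq t).differentiableAt, ?_⟩
  rw [funext fun t => (hasDerivAt_max_sq t).deriv]
  fun_prop

/-- A cutoff function supported where the squared distance to the origin is at most `R`. -/
noncomputable def cutoff (u : EuclideanSpace ℝ (Fin n) → EuclideanSpace ℝ (Fin m)) (R : ℝ)
    (x : EuclideanSpace ℝ (Fin n)) : ℝ :=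
  max 0 (1 - graphNormSq u x / R) ^ 2

theorem graphNormSq_nonneg (x : EuclideanSpace ℝ (Fin n)) : 0 ≤ graphNormSq u x :=
  add_nonneg (Finset.sum_nonneg fun _ _ => mul_self_nonneg _)
    (Finset.sum_nonneg fun _ _ => mul_self_nonneg _)

theorem norm_sq_le_graphNormSq (x : EuclideanSpace ℝ (Fin n)) : ‖x‖ ^ 2 ≤ graphNormSq u x := by
  rw [EuclideanSpace.real_norm_sq_eq, graphNormSq]
  simp_rw [pow_two]
  exact le_add_of_nonneg_right (Finset.sum_nonneg fun _ _ => mul_self_nonneg _)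

/-- An entire graph is proper: `|x| ≤ |X|`, so extrinsic balls have bounded parameter sets. -/
theorem hasCompactSupport_of_graphNormSq_lt {f : EuclideanSpace ℝ (Fin n) → ℝ} (R : ℝ)
    (h : ∀ x, R < graphNormSq u x → f x = 0) : HasCompactSupport f := by
  refine HasCompactSupport.intro (isCompact_closedBall 0 (Real.sqrt R)) fun x hx => h x ?_
  rw [mem_closedBall_zero_iff, not_le] at hx
  exact ((Real.sqrt_lt' ((Real.sqrt_nonneg _).trans_lt hx)).1 hx).trans_le
    (norm_sq_le_graphNormSq x)

theorem contDiff_cutoff (hu : ContDiff ℝ ∞ u) (R : ℝ) : ContDiff ℝ 1 (cutoff u R) :=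
  contDiff_max_sq.comp
    (contDiff_const.sub (((contDiff_graphNormSq hu).of_le (by simp)).div_const R))

theorem cutoff_nonneg (R : ℝ) (x : EuclideanSpace ℝ (Fin n)) : 0 ≤ cutoff u R x :=
  sq_nonneg _

theorem cutoff_le_one {R : ℝ} (hR : 0 < R) (x : EuclideanSpace ℝ (Fin n)) :
    cutoff u R x ≤ 1 := by
  refine pow_le_one₀ (le_max_left _ _) (max_le zero_le_one ?_)
  linarith [div_nonneg (graphNormSq_nonneg (u := u) x) hR.le]

theorem cutoff_mono {R R' : ℝ} (hR : 0 < R) (h : R ≤ R') (x : EuclideanSpace ℝ (Fin n)) :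
    cutoff u R x ≤ cutoff u R' x := by
  refine pow_le_pow_left₀ (le_max_left _ _) (max_le_max le_rfl (sub_le_sub_left ?_ _)) 2
  exact div_le_div_of_nonneg_left (graphNormSq_nonneg x) hR h

theorem cutoff_eq_zero {R : ℝ} (hR : 0 < R) {x : EuclideanSpace ℝ (Fin n)}
    (h : R < graphNormSq u x) : cutoff u R x = 0 := by
  have : 1 < graphNormSq u x / R := (one_lt_div hR).2 h
  rw [cutoff, max_eq_left (by linarith)]
  norm_num

theorem cutoff_pos {R : ℝ} (hR : 0 < R) {x : EuclideanSpace ℝ (Fin n)}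
    (h : graphNormSq u x < R) : 0 < cutoff u R x := by
  have : graphNormSq u x / R < 1 := (div_lt_one hR).2 h
  exact pow_pos (lt_max_of_lt_right (by linarith)) 2

/-- Squaring in `cutoff` leaves a factor `√η` in the derivative, so `|dη|²` is controlled by `η
|X|²` and not merely by `|X|²`. -/
theorem pd_cutoff (hu : ContDiff ℝ ∞ u) (R : ℝ) (i : Fin n) (x : EuclideanSpace ℝ (Fin n)) :
    pd i (cutoff u R) x =
      -(4 / R * max 0 (1 - graphNormSq u x / R)) * positionTangent u x i := by
  have hs : DifferentiableAt ℝ (graphNormSq u) x :=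
    (contDiff_graphNormSq hu).differentiable (by simp) x
  have h1 : HasDerivAt (fun t : ℝ => 1 - t / R) (-(1 / R)) (graphNormSq u x) :=
    ((hasDerivAt_id _).div_const R).const_sub 1
  have h2 : HasDerivAt (fun t : ℝ => max 0 (1 - t / R) ^ 2)
      (2 * max 0 (1 - graphNormSq u x / R) * -(1 / R)) (graphNormSq u x) :=
    (hasDerivAt_max_sq _).comp (graphNormSq u x) h1
  have h3 := pd_comp h2 hs i
  rw [pd_graphNormSq hu] at h3
  refine Eq.trans h3 ?_
  ring

theorem coInner_smul_left (x : EuclideanSpace ℝ (Fin n)) (c : ℝ) (v w : Fin n → ℝ) :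
    coInner u x (c • v) w = c * coInner u x v w := by
  simp [coInner]

theorem coInner_smul_right (x : EuclideanSpace ℝ (Fin n)) (c : ℝ) (v w : Fin n → ℝ) :
    coInner u x v (c • w) = c * coInner u x v w := by
  simp [coInner, mulVec_smul]

theorem coInner_comm (x : EuclideanSpace ℝ (Fin n)) (v w : Fin n → ℝ) :
    coInner u x v w = coInner u x w v := by
  rw [coInner, dotProduct_mulVec, ← mulVec_transpose, graphMetric_inv_transpose,
    dotProduct_comm, coInner]

theorem coInner_add_self (x : EuclideanSpace ℝ (Fin n)) (v w : Fin n → ℝ) :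
    coInner u x (v + w) (v + w) =
      coInner u x v v + 2 * coInner u x v w + coInner u x w w := by
  have h := coInner_comm (u := u) x w v
  simp only [coInner, mulVec_add, add_dotProduct, dotProduct_add] at h ⊢
  linarith

theorem continuous_coInner (hu : ContDiff ℝ ∞ u)
    {v w : EuclideanSpace ℝ (Fin n) → Fin n → ℝ} (hv : ∀ i, Continuous fun x => v x i)
    (hw : ∀ i, Continuous fun x => w x i) :
    Continuous fun x => coInner u x (v x) (w x) := by
  simp only [coInner, mulVec, dotProduct]
  exact continuous_finsetSum _ fun i _ => (hv i).mul
    (continuous_finsetSum _ fun j _ => (contDiff_graphMetric_inv hu i j).continuous.mul (hw j))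

theorem continuous_sffNormSq (hu : ContDiff ℝ ∞ u) : Continuous (sffNormSq u) := by
  have hh := fun i j => (contDiff_graphMetric_inv hu i j).continuous
  have hT := fun a i j => (contDiff_hess hu a i j).continuous
  have hQ := fun a i => (contDiff_raisedJac hu a i).continuous
  have hP := fun a i => (contDiff_jac hu a i).continuous
  unfold sffNormSq
  simp only [trace, diag_apply, Matrix.mul_apply, dotProduct]
  refine continuous_finsetSum _ fun a _ => continuous_finsetSum _ fun b _ => Continuous.mul
    (continuous_const.sub (continuous_finsetSum _ fun i _ => (hQ b i).mul (hP a i)))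
    (continuous_finsetSum _ fun i _ => continuous_finsetSum _ fun j _ => Continuous.mul ?_ ?_)
  · exact continuous_finsetSum _ fun k _ => (hh i k).mul (hT a k j)
  · exact continuous_finsetSum _ fun k _ => (hh j k).mul (hT b k i)

/-- Green's formula for the weighted divergence of a one-form. -/
theorem integral_mul_gaussDensity_mul_div (hs : IsSelfShrinker (graphMap u))
    (hu : ContDiff ℝ ∞ u) {φ : EuclideanSpace ℝ (Fin n) → ℝ} (hφ : ContDiff ℝ 1 φ)
    (hc : HasCompactSupport φ) {Y : EuclideanSpace ℝ (Fin n) → Fin n → ℝ}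
    (hY : ∀ j, ContDiff ℝ ∞ fun x => Y x j) :
    ∫ x, φ x * (gaussDensity u x * (∑ i, ∑ j, (graphMetric u x)⁻¹ i j *
        pd i (fun y => Y y j) x - x.ofLp ⬝ᵥ Y x)) =
      -∫ x, gaussDensity u x * coInner u x (fun i => pd i φ x) (Y x) := by
  have hZ : ∀ i, ContDiff ℝ ∞ fun y => gaussDensity u y * ((graphMetric u y)⁻¹ *ᵥ Y y) i := by
    intro i
    simp only [mulVec, dotProduct]
    exact (contDiff_gaussDensity hu).mul
      (ContDiff.sum fun j _ => (contDiff_graphMetric_inv hu i j).mul (hY j))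
  have hpφ : ∀ i, Continuous (pd i φ) := fun i =>
    (hφ.continuous_fderiv (by simp)).clm_apply continuous_const
  have hsφ : ∀ i, HasCompactSupport (pd i φ) := fun i => hc.fderiv_apply ℝ _
  simp_rw [← sum_pd_flux hs hu hY, Finset.mul_sum]
  rw [integral_finsetSum]
  · rw [Finset.sum_congr rfl fun i _ => integral_mul_pd hφ hc ((hZ i).of_le (by simp)) i,
      Finset.sum_neg_distrib, ← integral_finsetSum]
    · congr 2
      funext x
      rw [coInner, dotProduct, Finset.mul_sum]
      exact Finset.sum_congr rfl fun i _ => by ring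
    · exact fun i _ => ((hpφ i).mul (hZ i).continuous).integrable_of_hasCompactSupport
        (hsφ i).mul_right
  · exact fun i _ => (hφ.continuous.mul
      (contDiff_pd (hZ i) i).continuous).integrable_of_hasCompactSupport hc.mul_right

/-- Gaussian area bound: the truncated second moments are bounded independently of `R`. -/
theorem integral_cutoff_mul_graphNormSq_le (hs : IsSelfShrinker (graphMap u))
    (hu : ContDiff ℝ ∞ u) {R : ℝ} (hR : 0 < R) :
    ∫ x, gaussDensity u x * (cutoff u R x * graphNormSq u x) ≤
      ∫ x, gaussDensity u x * max 0 (2 * n - graphNormSq u x) := by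
  have hρ := (contDiff_gaussDensity hu).continuous
  have hη := (contDiff_cutoff hu R).continuous
  have hsc := (contDiff_graphNormSq hu).continuous
  have hc : HasCompactSupport (cutoff u R) :=
    hasCompactSupport_of_graphNormSq_lt (u := u) R fun x hx => cutoff_eq_zero hR hx
  have hgreen := integral_mul_gaussDensity_mul_div hs hu (contDiff_cutoff hu R) hc
    (contDiff_positionTangent hu)
  simp_rw [sum_inv_mul_pd_positionTangent hs hu] at hgreen
  -- The cutoff decreases with `|X|²`, so `dη` is a nonpositive multiple of `positionTangent` and
  -- Green's formula has a sign.
  have hnonneg : 0 ≤ ∫ x, cutoff u R x * (gaussDensity u x * (n - graphNormSq u x)) := by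
    rw [hgreen, ← integral_neg]
    refine integral_nonneg fun x => ?_
    have e : (fun i => pd i (cutoff u R) x) =
        (-(4 / R * max 0 (1 - graphNormSq u x / R))) • positionTangent u x :=
      funext fun i => pd_cutoff hu R i x
    simp only [e, coInner_smul_left, neg_mul, mul_neg, neg_neg, Pi.zero_apply]
    exact mul_nonneg (gaussDensity_pos x).le (mul_nonneg
      (mul_nonneg (by positivity) (le_max_left _ _)) (coInner_self_nonneg _ _))
  have i1 : Integrable fun x => cutoff u R x * (gaussDensity u x * (n - graphNormSq u x)) :=
    (hη.mul (hρ.mul (continuous_const.sub hsc))).integrable_of_hasCompactSupport hc.mul_right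
  have i2 : Integrable fun x => gaussDensity u x * (cutoff u R x * graphNormSq u x) :=
    (hρ.mul (hη.mul hsc)).integrable_of_hasCompactSupport (hc.mul_right.mul_left)
  have i3 : Integrable fun x => gaussDensity u x * max 0 (2 * n - graphNormSq u x) := by
    refine (hρ.mul (continuous_const.max
      (continuous_const.sub hsc))).integrable_of_hasCompactSupport
      (hasCompactSupport_of_graphNormSq_lt (u := u) (2 * n) fun x hx => ?_)
    change gaussDensity u x * max 0 (2 * n - graphNormSq u x) = 0
    rw [max_eq_left (by linarith), mul_zero]
  -- Adding twice the nonnegative integral changes `η|X|²` into `η(2n - |X|²)`, which is positive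
  -- only on a fixed compact set; hence the bound does not involve `R`.
  have hle : ∫ x, (gaussDensity u x * (cutoff u R x * graphNormSq u x) +
      2 * (cutoff u R x * (gaussDensity u x * (n - graphNormSq u x)))) ≤
      ∫ x, gaussDensity u x * max 0 (2 * n - graphNormSq u x) := by
    refine integral_mono (i2.add (i1.const_mul 2)) i3 fun x => ?_
    have h1 : cutoff u R x * (2 * n - graphNormSq u x) ≤ max 0 (2 * n - graphNormSq u x) :=
      calc _ ≤ cutoff u R x * max 0 (2 * n - graphNormSq u x) :=
            mul_le_mul_of_nonneg_left (le_max_right _ _) (cutoff_nonneg R x)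
        _ ≤ _ := mul_le_of_le_one_left (le_max_left _ _) (cutoff_le_one hR x)
    refine Eq.trans_le ?_ (mul_le_mul_of_nonneg_left h1 (gaussDensity_pos x).le)
    ring
  rw [integral_add i2 (i1.const_mul 2), integral_const_mul] at hle
  linarith

/-- The Caccioppoli type estimate for the second fundamental form. -/
theorem integral_cutoff_sq_mul_sffNormSq_le (hs : IsSelfShrinker (graphMap u))
    (hu : ContDiff ℝ ∞ u)
    (hcomm : ∀ x a b, hess u a x * ((graphMetric u x)⁻¹ * hess u b x) =
      hess u b x * ((graphMetric u x)⁻¹ * hess u a x)) {R : ℝ} (hR : 0 < R) :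
    ∫ x, gaussDensity u x * (cutoff u R x ^ 2 * sffNormSq u x) ≤
      16 / R ^ 2 * ∫ x, gaussDensity u x * (cutoff u R x * graphNormSq u x) := by
  have hρ := (contDiff_gaussDensity hu).continuous
  have hη := contDiff_cutoff hu R
  have hsc := (contDiff_graphNormSq hu).continuous
  have hA := continuous_sffNormSq hu
  have hq := fun i => (contDiff_logVolumeDeriv hu i).continuous
  have hc : HasCompactSupport (cutoff u R) :=
    hasCompactSupport_of_graphNormSq_lt (u := u) R fun x hx => cutoff_eq_zero hR hx
  have hc2 : HasCompactSupport fun x => cutoff u R x ^ 2 :=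
    hc.comp_left (g := fun t : ℝ => t ^ 2) (by norm_num)
  have hpη : ∀ i, Continuous (pd i (cutoff u R)) := fun i =>
    (hη.continuous_fderiv (by simp)).clm_apply continuous_const
  have hgreen := integral_mul_gaussDensity_mul_div hs hu (hη.pow 2) hc2
    (contDiff_logVolumeDeriv hu)
  simp_rw [fun x => sum_inv_mul_pd_logVolumeDeriv hs hu x (hcomm x)] at hgreen
  have e : ∀ x, (fun i => pd i (fun y => cutoff u R y ^ 2) x) =
      (2 * cutoff u R x) • fun i => pd i (cutoff u R) x := by
    intro x
    funext i
    have h := hasDerivAt_pow 2 (cutoff u R x)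
    rw [pd_comp h (hη.differentiable (by simp) x)]
    simp
  simp_rw [e, coInner_smul_left] at hgreen
  have hcI : Continuous fun x =>
      coInner u x (fun i => pd i (cutoff u R) x) (logVolumeDeriv u x) :=
    continuous_coInner hu hpη hq
  have hcq : Continuous fun x => coInner u x (logVolumeDeriv u x) (logVolumeDeriv u x) :=
    continuous_coInner hu hq hq
  have i1 : Integrable fun x => cutoff u R x ^ 2 * (gaussDensity u x *
      (sffNormSq u x + coInner u x (logVolumeDeriv u x) (logVolumeDeriv u x))) :=
    ((hη.continuous.pow 2).mul (hρ.mul (hA.add hcq))).integrable_of_hasCompactSupport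
      hc2.mul_right
  have i2 : Integrable fun x => gaussDensity u x * (2 * cutoff u R x *
      coInner u x (fun i => pd i (cutoff u R) x) (logVolumeDeriv u x)) :=
    (hρ.mul ((continuous_const.mul hη.continuous).mul hcI)).integrable_of_hasCompactSupport
      (hc.mul_left.mul_right.mul_left)
  have i3 : Integrable fun x => gaussDensity u x * (cutoff u R x * graphNormSq u x) :=
    (hρ.mul (hη.continuous.mul hsc)).integrable_of_hasCompactSupport hc.mul_right.mul_left
  have i4 : Integrable fun x => gaussDensity u x * (cutoff u R x ^ 2 * sffNormSq u x) :=
    (hρ.mul ((hη.continuous.pow 2).mul hA)).integrable_of_hasCompactSupport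
      hc2.mul_right.mul_left
  -- Pointwise this is `0 ≤ |dη + η dw|²` with `|dη|²` bounded by `16/R² · η|X|²`. After
  -- integration, Green's formula cancels the first two terms on the right.
  have hle := integral_mono i4 ((i1.add i2).add (i3.const_mul (16 / R ^ 2))) fun x => by
    have hd : (fun i => pd i (cutoff u R) x) =
        (-(4 / R * max 0 (1 - graphNormSq u x / R))) • positionTangent u x :=
      funext fun i => pd_cutoff hu R i x
    have h1 : coInner u x (fun i => pd i (cutoff u R) x) (fun i => pd i (cutoff u R) x) ≤
        16 / R ^ 2 * (cutoff u R x * graphNormSq u x) := by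
      rw [hd, coInner_smul_left, coInner_smul_right]
      have := mul_le_mul_of_nonneg_left (coInner_positionTangent_le (u := u) x)
        (mul_nonneg (by positivity : (0 : ℝ) ≤ 16 / R ^ 2) (cutoff_nonneg (u := u) R x))
      rw [mul_assoc (16 / R ^ 2)] at this
      refine le_of_eq_of_le ?_ (this.trans_eq (mul_assoc _ _ _))
      rw [cutoff]
      ring
    have h2 := coInner_self_nonneg (u := u) x
      ((fun i => pd i (cutoff u R) x) + cutoff u R x • logVolumeDeriv u x)
    rw [coInner_add_self, coInner_smul_left, coInner_smul_right, coInner_smul_right] at h2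
    simp only [Pi.add_apply]
    have h3 := mul_nonneg (gaussDensity_pos (u := u) x).le (h2.trans
      (add_le_add_left (add_le_add_left h1 _) _))
    linarith
  simp only [Pi.add_apply] at hle
  rw [integral_add (i1.fun_add i2) (i3.const_mul _), integral_add i1 i2, hgreen,
    integral_const_mul] at hle
  linarith

/-- If `|B|²` were nonzero at `x`, a fixed cutoff positive there would have a positive integral.
Cutoffs grow with `R`, so that integral stays below `16 K / R²` for all large `R`, which tends to
zero. -/
theorem sffNormSq_eq_zero (hs : IsSelfShrinker (graphMap u)) (hu : ContDiff ℝ ∞ u)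
    (hcomm : ∀ x a b, hess u a x * ((graphMetric u x)⁻¹ * hess u b x) =
      hess u b x * ((graphMetric u x)⁻¹ * hess u a x)) (x : EuclideanSpace ℝ (Fin n)) :
    sffNormSq u x = 0 := by
  by_contra hne
  have hρ := (contDiff_gaussDensity hu).continuous
  have hA := continuous_sffNormSq hu
  have hcf : ∀ {R : ℝ}, 0 < R →
      HasCompactSupport fun x => gaussDensity u x * (cutoff u R x ^ 2 * sffNormSq u x) := by
    intro R hR
    refine hasCompactSupport_of_graphNormSq_lt (u := u) R fun x hx => ?_
    rw [cutoff_eq_zero hR hx]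
    ring
  have hcont : ∀ R : ℝ,
      Continuous fun x => gaussDensity u x * (cutoff u R x ^ 2 * sffNormSq u x) :=
    fun R => hρ.mul (((contDiff_cutoff hu R).continuous.pow 2).mul hA)
  set K := ∫ x, gaussDensity u x * max 0 (2 * n - graphNormSq u x) with hK
  have hR0 : 0 < graphNormSq u x + 1 := by linarith [graphNormSq_nonneg (u := u) x]
  set I := ∫ y, gaussDensity u y * (cutoff u (graphNormSq u x + 1) y ^ 2 * sffNormSq u y)
    with hI
  have hIpos : 0 < I := by
    refine (hcont _).integral_pos_of_hasCompactSupport_nonneg_nonzero (hcf hR0)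
      (fun y => mul_nonneg (gaussDensity_pos y).le
        (mul_nonneg (sq_nonneg _) (sffNormSq_nonneg hu y))) (x := x) ?_
    exact mul_ne_zero (gaussDensity_pos x).ne'
      (mul_ne_zero (pow_ne_zero _ (cutoff_pos hR0 (by linarith)).ne') hne)
  have hbound : ∀ R, graphNormSq u x + 1 ≤ R → I ≤ 16 / R ^ 2 * K := by
    intro R hR
    have hRpos := hR0.trans_le hR
    calc I ≤ ∫ y, gaussDensity u y * (cutoff u R y ^ 2 * sffNormSq u y) := by
          refine integral_mono ((hcont _).integrable_of_hasCompactSupport (hcf hR0))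
            ((hcont _).integrable_of_hasCompactSupport (hcf hRpos)) fun y => ?_
          exact mul_le_mul_of_nonneg_left (mul_le_mul_of_nonneg_right
            (pow_le_pow_left₀ (cutoff_nonneg _ _) (cutoff_mono hR0 hR y) 2)
            (sffNormSq_nonneg hu y)) (gaussDensity_pos y).le
      _ ≤ _ := integral_cutoff_sq_mul_sffNormSq_le hs hu hcomm hRpos
      _ ≤ _ := mul_le_mul_of_nonneg_left (integral_cutoff_mul_graphNormSq_le hs hu hRpos)
          (by positivity)
  have hlim : Filter.Tendsto (fun R : ℝ => 16 / R ^ 2 * K) Filter.atTop (nhds 0) := by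
    simpa using ((Filter.tendsto_pow_atTop (two_ne_zero)).const_div_atTop (16 : ℝ)).mul_const K
  have := ge_of_tendsto hlim
    (Filter.eventually_atTop.2 ⟨graphNormSq u x + 1, fun R hR => hbound R hR⟩)
  linarith

/-- A graphical self-shrinker with vanishing Hessian is linear. -/
theorem isLinearMap_graphMap (hs : IsSelfShrinker (graphMap u)) (hu : ContDiff ℝ ∞ u)
    (hess_zero : ∀ a x, hess u a x = 0) : IsLinearMap ℝ (graphMap u) := by
  have hconst : ∀ a i x, jac u x a i = jac u 0 a i := by
    intro a i x
    refine is_const_of_fderiv_eq_zero (𝕜 := ℝ) (f := fun y => jac u y a i)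
      ((contDiff_jac hu a i).differentiable (by simp)) (fun y => ?_) x 0
    ext v
    rw [fderiv_apply_eq_sum_pd]
    simp [pd_jac, hess_zero]
  -- Vanishing Hessians only make `u` affine; the zeroth-order term of the shrinker equation
  -- excludes a constant.
  have hlin : ∀ x a, u x a = ∑ k, x k * jac u 0 a k := by
    intro x a
    have h := hs.sum_inv_mul_hess hu a x
    simp only [hess_zero, Matrix.zero_apply, mul_zero, Finset.sum_const_zero, hconst _ _ x] at h
    linarith
  constructor
  · intro x y
    ext (i | a)
    · rfl
    · simp [graphMap, hlin, add_mul, Finset.sum_add_distrib]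
  · intro c x
    ext (i | a)
    · rfl
    · simp [graphMap, hlin, Finset.mul_sum, mul_assoc]

end Integration

end SelfShrinker

theorem mainTheorem5 (n m : ℕ)
    (u : EuclideanSpace ℝ (Fin n) → EuclideanSpace ℝ (Fin m))
    (hu : ContDiff ℝ ∞ u)
    (hshrink : SelfShrinker.IsSelfShrinker (SelfShrinker.graphMap u))
    (h : SelfShrinker.HasFlatNormalBundle (SelfShrinker.graphMap u) ∨ m = 1) :
    ∃ S : Submodule ℝ (EuclideanSpace ℝ (Fin n ⊕ Fin m)),
      Set.range (SelfShrinker.graphMap u) = (S : Set _) := by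
  have hcomm : ∀ x a b, SelfShrinker.hess u a x *
      ((SelfShrinker.graphMetric u x)⁻¹ * SelfShrinker.hess u b x) =
      SelfShrinker.hess u b x * ((SelfShrinker.graphMetric u x)⁻¹ * SelfShrinker.hess u a x) := by
    intro x a b
    rcases h with hflat | rfl
    · exact hflat.hess_mul_inv_mul_hess hu a b x
    -- In codimension one there is a single shape operator.
    · rw [Subsingleton.elim a b]
  have hlin := SelfShrinker.isLinearMap_graphMap hshrink hu fun a x =>
    SelfShrinker.hess_eq_zero_of_sffNormSq_eq_zero hu
      (SelfShrinker.sffNormSq_eq_zero hshrink hu hcomm x) a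
  exact ⟨LinearMap.range hlin.mk', by rw [LinearMap.coe_range]; rfl⟩
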